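/- For an integer $k\ge 3$ or $k=\infty$ let $\Gamma_k\subset \mathrm{PSL}(2,\mathbb R)$ be the $(2,k,\infty)$ Hecke group, generated by $A=\begin{pmatrix}0&-1\\1&0\end{pmatrix}$ and $B=\begin{pmatrix}0&-1\\1&2\cos(\pi/k)\end{pmatrix}$ (with $2\cos(\pi/k)$ replaced by $2$ for $k=\infty$), and let $X_k=\mathbb H/\Gamma_k$ be the Hecke surface, whose cone point of order 2 is the image $p$ of $i\in\mathbb H$. A closed geodesic on $X_k$ (traversed a given number of times) is a conjugacy class of hyperbolic elements of $\Gamma_k$. It is a reciprocal geodesic based at order 2 if some element of the class is a product of two distinct conjugate involutions of $\Gamma_k$ whose fixed points in $\mathbb H$ project to $p$. Its length $|\gamma|$ is the least word length, with respect to $\{A,B,B^{-1}\}$, of the elements of the class, and it is primitive if its elements are not non-trivial powers of elements of $\Gamma_k$. Let $\mathcal R_{n}$ be the set of reciprocal geodesics based at order 2 with $|\gamma|=n$, and $\mathcal R^p_{n}$ the set of primitive ones. For finite $k$ let $|\mathcal N_{2t}|$ be the number of elements of $\Gamma_k$ of word length $2t$ of the form $[A,h]=AhA^{-1}h^{-1}$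 with $h=B^{x_0}AB^{x_1}A\cdots AB^{x_{n-1}}$, $n\ge1$, where the exponents $x_i$ are nonzero integers with $-\lfloor (k-1)/2\rfloor\le x_i\le\lfloor k/2\rfloor$. **Theorem A (Based at order 2).** 1. Let $k=2m+1$ with $m\ge2$. The polynomial $x^{m+1}-2x^{m-1}-2x^{m-2}-\dots-2x-2$ has a unique positive root $\alpha_{2m+1}$. There is a positive constant $c_{2m+1}$, namely the coefficient of $\alpha_{2m+1}^t$ when $|\mathcal N_{2t}|$ is written, for all $t\ge1$, as a linear combination of the $t$-th powers of the distinct complex roots of this polynomial, such that $$\frac{|\mathcal R_{2t}|}{\alpha_{2m+1}^t}\xrightarrow{t\to\infty}\frac{c_{2m+1}}2 .$$ 2. Let $k=2m$ with $m\ge2$. The polynomial $x^{m+1}-2x^{m-1}-2x^{m-2}-\dots-2x-1$ has a unique positive root $\beta_{2m}$. There is a positive constant $d_{2m}$, namely the coefficient of $\beta_{2m}^t$ when $|\mathcal N_{2t}|$ is written, for all $t\ge1$, as a linear combination of the $t$-th powers of the distinct complex roots of this polynomial, such that $$\frac{|\mathcal R_{2t}|}{\beta_{2m}^t}\xrightarrow{t\to\infty}\frac{d_{2m}}2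 .$$ 3. Let $k=\infty$. Then $$\frac{|\mathcal R_{2t}|}{2^t}\xrightarrow{t\to\infty}\frac16 .$$ In all three items the same limit holds with $\mathcal R_{2t}$ replaced by the set $\mathcal R^p_{2t}$ of primitive reciprocal geodesics. -/

import Mathlib

open scoped MatrixGroups UpperHalfPlane Polynomial

noncomputable section

/-! ## Word length, conjugacy class length and primitivity in a group generated by `a` and `b` -/

section Words

variable {G : Type*} [Group G]

/-- The word length of `g` with respect to `{a, b, b⁻¹}` (`a` will be an involution): the least
length of a word in these letters that represents `g`. -/
def wordLength (a b g : G) : ℕ :=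
  sInf {n : ℕ | ∃ l : List G, (∀ x ∈ l, x = a ∨ x = b ∨ x = b⁻¹) ∧ l.prod = g ∧ l.length = n}

/-- The length of a conjugacy class: the least word length of its elements. -/
def classLength (a b : G) (γ : ConjClasses G) : ℕ :=
  sInf {n : ℕ | ∃ g ∈ γ.carrier, wordLength a b g = n}

/-- An element is primitive if it is not a non-trivial power of an element of the group. -/
def IsPrimitiveElement (g : G) : Prop :=
  ∀ (h : G) (n : ℕ), h ^ n = g → n = 1

/-- `IsBBWord a b E g`: `g` is represented by a word `b ^ x₀ * a * b ^ x₁ * a * ⋯ * a * b ^ xₙ`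
with all exponents in `E` (a reduced word that begins and ends with a power of `b`). -/
inductive IsBBWord (a b : G) (E : Set ℤ) : G → Prop
  | single (x : ℤ) (hx : x ∈ E) : IsBBWord a b E (b ^ x)
  | cons (x : ℤ) (hx : x ∈ E) (h : G) (hh : IsBBWord a b E h) : IsBBWord a b E (b ^ x * a * h)

/-- The commutators `[a, h] = a * h * a⁻¹ * h⁻¹` of word length `n`, for `h` a word as above. -/
def normalForms (a b : G) (E : Set ℤ) (n : ℕ) : Set G :=
  {w | (∃ h, IsBBWord a b E h ∧ w = a * h * a⁻¹ * h⁻¹) ∧ wordLength a b w = n}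

end Words

/-! ## The Hecke groups and the Hecke surfaces -/

/-- The action of `PSL(2, ℝ)` on the upper half-plane by Möbius transformations. -/
instance pslActionUpperHalfPlane : MulAction PSL(2, ℝ) ℍ :=
  MulAction.compHom ℍ (Matrix.ProjectiveSpecialLinearGroup.toPGL : PSL(2, ℝ) →* PGL(2, ℝ))

/-- A check that this is the usual action. -/
theorem psl_mk_smul (M : SL(2, ℝ)) (z : ℍ) : (QuotientGroup.mk M : PSL(2, ℝ)) • z = M • z :=
  rfl

/-- The trace `2 cos (π / k)` of the second generator; it is `2` for `k = ∞`. -/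
def heckeTrace (k : ℕ∞) : ℝ :=
  ENat.recTopCoe (C := fun _ => ℝ) 2 (fun n => 2 * Real.cos (Real.pi / n)) k

/-- The matrix `(0 -1; 1 x)`. -/
def slMatrix (x : ℝ) : SL(2, ℝ) :=
  ⟨!![0, -1; 1, x], by simp [Matrix.det_fin_two]⟩

/-- `A = (0 -1; 1 0)` in `PSL(2, ℝ)`. -/
def matA : PSL(2, ℝ) :=
  QuotientGroup.mk (slMatrix 0)

/-- `B = (0 -1; 1 2 cos (π / k))` in `PSL(2, ℝ)`. -/
def matB (k : ℕ∞) : PSL(2, ℝ) :=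
  QuotientGroup.mk (slMatrix (heckeTrace k))

/-- The `(2, k, ∞)` Hecke group, the subgroup of `PSL(2, ℝ)` generated by `A` and `B`. -/
def heckeGroup (k : ℕ∞) : Subgroup PSL(2, ℝ) :=
  Subgroup.closure {matA, matB k}

/-- The generator `A` as an element of the Hecke group. -/
def genA (k : ℕ∞) : heckeGroup k :=
  ⟨matA, Subgroup.subset_closure (by simp)⟩

/-- The generator `B` as an element of the Hecke group. -/
def genB (k : ℕ∞) : heckeGroup k :=
  ⟨matB k, Subgroup.subset_closure (by simp)⟩

/-- The `(2, k, ∞)` Hecke surface: the quotient of the upper half-plane by the Hecke group. -/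
abbrev HeckeSurface (k : ℕ∞) : Type :=
  MulAction.orbitRel.Quotient (heckeGroup k) ℍ

/-- The projection from the upper half-plane to the Hecke surface. -/
def toHeckeSurface (k : ℕ∞) (z : ℍ) : HeckeSurface k :=
  Quotient.mk (MulAction.orbitRel (heckeGroup k) ℍ) z

/-- The cone point of order 2 of the Hecke surface: the image of `i`, the fixed point of `A`. -/
def conePointTwo (k : ℕ∞) : HeckeSurface k :=
  toHeckeSurface k UpperHalfPlane.I

/-! ## Reciprocal geodesics -/

/-- An element of the Hecke group is hyperbolic if its lifts to `SL(2, ℝ)` are (`|trace| > 2`). -/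
def IsHyperbolicElement {k : ℕ∞} (g : heckeGroup k) : Prop :=
  ∃ M : SL(2, ℝ), (QuotientGroup.mk M : PSL(2, ℝ)) = (g : PSL(2, ℝ)) ∧
    (M : Matrix (Fin 2) (Fin 2) ℝ).IsHyperbolic

/-- `u` is an involution of the Hecke group whose fixed point in the upper half-plane projects
to the point `p` of the Hecke surface. -/
def IsInvolutionOver {k : ℕ∞} (p : HeckeSurface k) (u : heckeGroup k) : Prop :=
  orderOf u = 2 ∧ ∃ z : ℍ, u • z = z ∧ toHeckeSurface k z = p

/-- A reciprocal hyperbolic element at `p`: a hyperbolic element of the Hecke group that is the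
product of two distinct conjugate involutions whose fixed points project to `p`. -/
def IsReciprocalAt {k : ℕ∞} (p : HeckeSurface k) (g : heckeGroup k) : Prop :=
  IsHyperbolicElement g ∧ ∃ u v : heckeGroup k, u ≠ v ∧ IsConj u v ∧
    IsInvolutionOver p u ∧ IsInvolutionOver p v ∧ g = u * v

/-- The reciprocal geodesics based at `p` of word length `n`. A closed geodesic of the surface,
with the number of times it is traversed, is a conjugacy class of hyperbolic elements. -/
def reciprocalGeodesics (k : ℕ∞) (p : HeckeSurface k) (n : ℕ) : Set (ConjClasses (heckeGroup k)) :=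
  {γ | (∃ g, IsReciprocalAt p g ∧ ConjClasses.mk g = γ) ∧
    classLength (genA k) (genB k) γ = n}

/-- The primitive ones among them. -/
def primitiveReciprocalGeodesics (k : ℕ∞) (p : HeckeSurface k) (n : ℕ) :
    Set (ConjClasses (heckeGroup k)) :=
  {γ | γ ∈ reciprocalGeodesics k p n ∧ ∃ g, IsPrimitiveElement g ∧ ConjClasses.mk g = γ}

/-- `C` is the limiting constant, with growth rate `ρ`, for the number of reciprocal geodesics
based at `p` of word length `2t`, and for the number of primitive ones. -/
def HasReciprocalAsymptotics (k : ℕ∞) (p : HeckeSurface k) (ρ C : ℝ) : Prop :=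
  Filter.Tendsto (fun t : ℕ => ((reciprocalGeodesics k p (2 * t)).ncard : ℝ) / ρ ^ t)
      Filter.atTop (nhds C) ∧
  Filter.Tendsto (fun t : ℕ => ((primitiveReciprocalGeodesics k p (2 * t)).ncard : ℝ) / ρ ^ t)
      Filter.atTop (nhds C)

/-! ## The polynomials and the constants -/

/-- `x ^ (m + 1) - 2 x ^ (m - 1) - ⋯ - 2 x - 2`. -/
def oddPoly (m : ℕ) : ℝ[X] :=
  Polynomial.X ^ (m + 1) - ∑ j ∈ Finset.Icc 0 (m - 1), 2 * Polynomial.X ^ j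

/-- `x ^ (m + 1) - 2 x ^ (m - 1) - ⋯ - 2 x - 1`. -/
def evenPoly (m : ℕ) : ℝ[X] :=
  Polynomial.X ^ (m + 1) - ∑ j ∈ Finset.Icc 1 (m - 1), 2 * Polynomial.X ^ j - 1

/-- `ρ` is the unique positive root of `P`. -/
def IsUniquePositiveRoot (P : ℝ[X]) (ρ : ℝ) : Prop :=
  (0 < ρ ∧ P.IsRoot ρ) ∧ ∀ x : ℝ, 0 < x → P.IsRoot x → x = ρ

/-- The exponents allowed on `b` in reduced words:
the nonzero integers from `-⌊(k - 1) / 2⌋` to `⌊k / 2⌋`. -/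
def exponentSet (k : ℕ) : Set ℤ :=
  {l | l ≠ 0 ∧ -(((k : ℤ) - 1) / 2) ≤ l ∧ l ≤ (k : ℤ) / 2}

/-- The number of normal forms `[A, h]` of word length `2t` in the Hecke group, `k` finite. -/
def normalFormCount (k : ℕ) (t : ℕ) : ℕ :=
  (normalForms (genA k) (genB k) (exponentSet k) (2 * t)).ncard

/-- `c` is the coefficient of `ρ ^ t` when the number `N t` is written, for all `t ≥ 1`, as a
linear combination of the `t`-th powers of the (distinct) complex roots of `P`. -/
def IsCoefficientOf (P : ℝ[X]) (N : ℕ → ℕ) (ρ c : ℝ) : Prop :=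
  ∃ a : ℂ → ℂ, a (ρ : ℂ) = (c : ℂ) ∧
    ∀ t : ℕ, 1 ≤ t → (N t : ℂ) = ∑ z ∈ (P.rootSet_finite ℂ).toFinset, a z * z ^ t

end

/-!
The Hecke group is the free product of `⟨A⟩`, of order two, and `⟨B⟩`, of order `k`. Freeness is
proved on matrices: up to sign, `A * B ^ j` has nonnegative entries and diagonal entries at least
`1` whenever `B ^ j ≠ 1` (`IsChebyshev.isPos`), such matrices are closed under products, and
multiplication by `A` destroys the sign pattern. Hence the products of the elements `A * B ^ x`,
over the lists of reduced exponents `x`, are pairwise distinct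
(`HasPositivePowers.positiveWord_injective`). As `A` conjugates such a *positive word* to the
inverse of the positive word of the flipped list (reversed, exponents inverted), every element of
the group is a positive word up to factors `A` on the left and on the right, and questions on the
group become questions on lists: conjugate positive words are rotations of each other
(`IsFreePair.isRotated_of_isConj`), and the length of the class of a positive word is its weight,
the sum of `1 + |x|` over the letters (`IsFreePair.classLength_positiveWord`).

The involutions over the cone point are the conjugates of `A`, because `A` is the only involution
fixing `i`; a product of two different ones is automatically hyperbolic. Up to conjugation it is
`[A, A * w]` for a positive word `w`, that is, the positive word of `l` followed by the flip of
`l`. So the reciprocal geodesics of length `2t` are the classes attached to the lists `l` of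
weight `t` (`reciprocalGeodesics_eq`), and these lists also enumerate the normal forms of length
`2t` (`IsFreePair.ncard_normalForms`). The lists `l` and `flip l` give the same class, and at most
two lists do, since a cyclic word has at most two flip-invariant starting points in a period
(`eq_or_eq_or_eq_of_isRotated`). The exceptions `l = flip l` and the imprimitive classes come from
proper powers of flip-invariant words; such a power is determined by a list of half the weight, so
they are negligible (`IsFreePair.tendsto_card_imprimitiveWords`). Both limits are therefore half
the limit for the number of lists of weight `t`.

That number satisfies the linear recurrence obtained from the first letter. Its characteristic
polynomial is the polynomial `P` of the theorem, its initial values are `0, …, 0, 1`, and if all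
roots are simple then Lagrange interpolation gives the solution `∑ z ^ m / P'(z) * z ^ t`
(`eq_sum_rootCoefficient`). The unique positive root dominates the others by the triangle
inequality (`norm_lt_of_root`) and has a positive coefficient. The roots are simple because
`(X - 1) * P` has few terms: a multiple root would be real, it is not positive as the derivative is
positive at the positive root, and a direct estimate excludes negative ones
(`simple_roots_one`, `simple_roots_two`). For `k = ∞` the number of lists is
`(2 ^ t + 2 * (-1) ^ t) / 3`.
-/

noncomputable section

/-! ### Positive words in a free product -/

section PositiveWords

variable {G : Type*} [Group G]

/-- The product of the elements `a * b ^ x` over the letters `x` of the list `l`. -/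
def positiveWord (a b : G) {E : Set ℤ} (l : List E) : G :=
  (l.map fun x => a * b ^ (x : ℤ)).prod

/-- The word length of `positiveWord a b l`: a letter `x` stands for `a * b ^ x` and counts
`1 + |x|`. -/
def weight {E : Set ℤ} (l : List E) : ℕ :=
  (l.map fun x => 1 + (x : ℤ).natAbs).sum

/-- The list read backwards with each letter `x` replaced by `ν x`, where `ν` is the inversion
of exponents: up to conjugation by `a`, it represents the inverse. -/
def flipWord {E : Set ℤ} (ν : E → E) (l : List E) : List E :=
  (l.map ν).reverse

/-- The elements `a` and `b` generate `G` as the free product of a group of order two and a cyclic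
group whose nontrivial elements are the powers of `b` with exponents in `E`, each exponent being
of least absolute value; `ν` is the inversion in that cyclic group. Freeness is expressed by two
facts about the monoid of positive words: it is free on the letters, and it does not meet its
translate by `a`. -/
structure IsFreePair (a b : G) (E : Set ℤ) (ν : E → E) : Prop where
  a_mul_a : a * a = 1
  closure_eq_top : Subgroup.closure {a, b} = ⊤
  zpow_eq : ∀ z : ℤ, b ^ z = 1 ∨ ∃ x : E, b ^ z = b ^ (x : ℤ) ∧ (x : ℤ).natAbs ≤ z.natAbs
  zpow_inversion : ∀ x : E, b ^ (ν x : ℤ) = (b ^ (x : ℤ))⁻¹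
  natAbs_inversion : ∀ x : E, (ν x : ℤ).natAbs = (x : ℤ).natAbs
  inversion_inversion : ∀ x : E, ν (ν x) = x
  positiveWord_injective : Function.Injective (positiveWord a b : List E → G)
  mul_positiveWord_ne : ∀ l l' : List E, a * positiveWord a b l ≠ positiveWord a b l'

section Basic

variable {a b : G} {E : Set ℤ} {ν : E → E}

@[simp] theorem positiveWord_nil : positiveWord a b ([] : List E) = 1 := rfl

@[simp] theorem positiveWord_cons (x : E) (l : List E) :
    positiveWord a b (x :: l) = a * b ^ (x : ℤ) * positiveWord a b l := by
  simp [positiveWord]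

@[simp] theorem positiveWord_append (l l' : List E) :
    positiveWord a b (l ++ l') = positiveWord a b l * positiveWord a b l' := by
  simp [positiveWord]

@[simp] theorem weight_nil : weight ([] : List E) = 0 := rfl

@[simp] theorem weight_cons (x : E) (l : List E) :
    weight (x :: l) = 1 + (x : ℤ).natAbs + weight l := by
  simp [weight]

@[simp] theorem weight_append (l l' : List E) : weight (l ++ l') = weight l + weight l' := by
  simp [weight]

theorem length_le_weight (l : List E) : l.length ≤ weight l := by
  induction l with
  | nil => simp
  | cons x l ih => simp only [List.length_cons, weight_cons]; omega

theorem weight_eq_of_perm {l l' : List E} (h : l.Perm l') : weight l = weight l' := by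
  induction h with
  | nil => rfl
  | cons x _ ih => rw [weight_cons, weight_cons, ih]
  | swap x y l => simp only [weight_cons]; omega
  | trans _ _ ih1 ih2 => exact ih1.trans ih2

@[simp] theorem flipWord_nil : flipWord ν [] = [] := rfl

@[simp] theorem flipWord_cons (x : E) (l : List E) :
    flipWord ν (x :: l) = flipWord ν l ++ [ν x] := by
  simp [flipWord]

@[simp] theorem flipWord_append (l l' : List E) :
    flipWord ν (l ++ l') = flipWord ν l' ++ flipWord ν l := by
  simp [flipWord]

@[simp] theorem length_flipWord (l : List E) : (flipWord ν l).length = l.length := by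
  simp [flipWord]

end Basic

namespace IsFreePair

variable {a b : G} {E : Set ℤ} {ν : E → E}

theorem inv_a (h : IsFreePair a b E ν) : a⁻¹ = a := inv_eq_of_mul_eq_one_left h.a_mul_a

theorem a_mul_a_mul (h : IsFreePair a b E ν) (g : G) : a * (a * g) = g := by
  rw [← mul_assoc, h.a_mul_a, one_mul]

theorem flipWord_flipWord (h : IsFreePair a b E ν) (l : List E) :
    flipWord ν (flipWord ν l) = l := by
  induction l with
  | nil => rfl
  | cons x l ih => simp [ih, h.inversion_inversion]

theorem weight_flipWord (h : IsFreePair a b E ν) (l : List E) :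
    weight (flipWord ν l) = weight l := by
  induction l with
  | nil => rfl
  | cons x l ih => simp [ih, h.natAbs_inversion]; omega

/-- Conjugation by `a` turns a positive word into the inverse of the flipped positive word. -/
theorem inv_positiveWord_flipWord (h : IsFreePair a b E ν) (l : List E) :
    (positiveWord a b (flipWord ν l))⁻¹ = a * positiveWord a b l * a := by
  induction l with
  | nil => simp [h.a_mul_a]
  | cons x l ih =>
    simp only [flipWord_cons, positiveWord_append, mul_inv_rev, ih, positiveWord_cons,
      positiveWord_nil, mul_one, h.zpow_inversion, inv_inv, h.inv_a]
    simp only [mul_assoc, h.a_mul_a_mul]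

theorem mul_positiveWord (h : IsFreePair a b E ν) (l : List E) :
    a * positiveWord a b l = (positiveWord a b (flipWord ν l))⁻¹ * a := by
  rw [h.inv_positiveWord_flipWord, mul_assoc, h.a_mul_a, mul_one]

theorem positiveWord_ne_one (h : IsFreePair a b E ν) {l : List E} (hl : l ≠ []) :
    positiveWord a b l ≠ 1 := fun h1 =>
  hl (h.positiveWord_injective (h1.trans positiveWord_nil.symm))

theorem zpow_mul_positiveWord (h : IsFreePair a b E ν) (z : ℤ) (l : List E) :
    b ^ z * positiveWord a b l = positiveWord a b l ∨
      ∃ y : E, (y : ℤ).natAbs ≤ z.natAbs ∧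
        b ^ z * positiveWord a b l = a * positiveWord a b (y :: l) := by
  rcases h.zpow_eq z with hz | ⟨y, hy, hyz⟩
  · left; simp [hz]
  · right
    refine ⟨y, hyz, ?_⟩
    simp only [positiveWord_cons, mul_assoc, h.a_mul_a_mul, hy]

/-- Every word in `a`, `b`, `b⁻¹` can be brought to a normal form without becoming longer. -/
theorem exists_normalForm (h : IsFreePair a b E ν) (w : List G)
    (hw : ∀ x ∈ w, x = a ∨ x = b ∨ x = b⁻¹) :
    ∃ l : List E, (w.prod = positiveWord a b l ∧ weight l ≤ w.length) ∨
      (w.prod = a * positiveWord a b l ∧ l ≠ [] ∧ weight l ≤ w.length + 1) ∨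
      (w.prod = positiveWord a b l * a ∧ weight l + 1 ≤ w.length) ∨
      (w.prod = a * positiveWord a b l * a ∧ l ≠ [] ∧ weight l ≤ w.length) := by
  induction w with
  | nil => exact ⟨[], by simp⟩
  | cons g w ih =>
    obtain ⟨l, hl⟩ := ih fun x hx => hw x (by simp [hx])
    simp only [List.prod_cons, List.length_cons]
    have hg : g = a ∨ ∃ e : ℤ, e.natAbs = 1 ∧ g = b ^ e := by
      rcases hw g (by simp) with h1 | h1 | h1
      · exact .inl h1
      · exact .inr ⟨1, rfl, by simp [h1]⟩
      · exact .inr ⟨-1, rfl, by simp [h1]⟩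
    rcases hg with rfl | ⟨e, he, rfl⟩
    · rcases hl with ⟨hp, hn⟩ | ⟨hp, hne, hn⟩ | ⟨hp, hn⟩ | ⟨hp, hne, hn⟩
      · by_cases hne : l = []
        · subst hne
          exact ⟨[], .inr (.inr (.inl ⟨by simp [hp], by simp⟩))⟩
        · exact ⟨l, .inr (.inl ⟨by rw [hp], hne, by omega⟩)⟩
      · exact ⟨l, .inl ⟨by rw [hp, h.a_mul_a_mul], hn⟩⟩
      · by_cases hne : l = []
        · subst hne
          exact ⟨[], .inl ⟨by simp [hp, h.a_mul_a], by simp⟩⟩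
        · exact ⟨l, .inr (.inr (.inr ⟨by rw [hp, mul_assoc], hne, by omega⟩))⟩
      · exact ⟨l, .inr (.inr (.inl ⟨by rw [hp, mul_assoc, h.a_mul_a_mul], by omega⟩))⟩
    · -- a power of `b` is absorbed by the leading power of `b`, if there is one
      have key : ∀ (x : E) (l : List E),
          b ^ e * (a * positiveWord a b (x :: l)) = positiveWord a b l ∨ ∃ y : E,
            (y : ℤ).natAbs ≤ (x : ℤ).natAbs + 1 ∧ b ^ e * (a * positiveWord a b (x :: l)) =
              a * positiveWord a b (y :: l) := by
        intro x l
        have h1 : b ^ e * (a * positiveWord a b (x :: l)) =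
            b ^ (e + x : ℤ) * positiveWord a b l := by
          simp only [positiveWord_cons, mul_assoc, h.a_mul_a_mul, zpow_add]
        rw [h1]
        rcases h.zpow_mul_positiveWord (e + x) l with h2 | ⟨y, hy, h2⟩
        · exact .inl h2
        · exact .inr ⟨y, by omega, h2⟩
      rcases hl with ⟨hp, hn⟩ | ⟨hp, hne, hn⟩ | ⟨hp, hn⟩ | ⟨hp, hne, hn⟩
      · rcases h.zpow_mul_positiveWord e l with h2 | ⟨y, hy, h2⟩
        · exact ⟨l, .inl ⟨by rw [hp, h2], by omega⟩⟩
        · exact ⟨y :: l, .inr (.inl ⟨by rw [hp, h2], by simp, by simp only [weight_cons]; omega⟩)⟩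
      · obtain ⟨x, l, rfl⟩ := List.exists_cons_of_ne_nil hne
        simp only [weight_cons] at hn
        rcases key x l with h2 | ⟨y, hy, h2⟩
        · exact ⟨l, .inl ⟨by rw [hp, h2], by omega⟩⟩
        · exact ⟨y :: l, .inr (.inl ⟨by rw [hp, h2], by simp, by simp only [weight_cons]; omega⟩)⟩
      · rcases h.zpow_mul_positiveWord e l with h2 | ⟨y, hy, h2⟩
        · exact ⟨l, .inr (.inr (.inl ⟨by rw [hp, ← mul_assoc, h2], by omega⟩))⟩
        · exact ⟨y :: l, .inr (.inr (.inr ⟨by rw [hp, ← mul_assoc, h2], by simp,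
            by simp only [weight_cons]; omega⟩))⟩
      · obtain ⟨x, l, rfl⟩ := List.exists_cons_of_ne_nil hne
        simp only [weight_cons] at hn
        rcases key x l with h2 | ⟨y, hy, h2⟩
        · exact ⟨l, .inr (.inr (.inl ⟨by rw [hp, ← mul_assoc, h2], by omega⟩))⟩
        · exact ⟨y :: l, .inr (.inr (.inr ⟨by rw [hp, ← mul_assoc, h2], by simp,
            by simp only [weight_cons]; omega⟩))⟩

theorem exists_word (h : IsFreePair a b E ν) (g : G) :
    ∃ w : List G, (∀ x ∈ w, x = a ∨ x = b ∨ x = b⁻¹) ∧ w.prod = g := by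
  have hg : g ∈ Subgroup.closure {a, b} := h.closure_eq_top ▸ Subgroup.mem_top g
  rw [← Subgroup.mem_toSubmonoid, Subgroup.closure_toSubmonoid] at hg
  obtain ⟨w, hw, rfl⟩ := Submonoid.exists_list_of_mem_closure hg
  refine ⟨w, fun x hx => ?_, rfl⟩
  have := hw x hx
  simp only [Set.mem_union, Set.mem_inv, Set.mem_insert_iff, Set.mem_singleton_iff] at this
  rcases this with (h1 | h1) | h1 | h1
  · exact .inl h1
  · exact .inr (.inl h1)
  · exact .inl (by rw [← inv_inv x, h1, h.inv_a])
  · exact .inr (.inr (by rw [← h1, inv_inv]))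

theorem exists_positiveWord_eq (h : IsFreePair a b E ν) (g : G) :
    ∃ l : List E, g = positiveWord a b l ∨ g = a * positiveWord a b l ∨
      g = positiveWord a b l * a ∨ g = a * positiveWord a b l * a := by
  obtain ⟨w, hw, rfl⟩ := h.exists_word g
  obtain ⟨l, hl⟩ := h.exists_normalForm w hw
  exact ⟨l, by tauto⟩

/-! ### Cyclic reduction and conjugacy -/

theorem isConj_positiveWord_append_comm (l l' : List E) :
    IsConj (positiveWord a b (l ++ l')) (positiveWord a b (l' ++ l)) :=
  isConj_iff.2 ⟨(positiveWord a b l)⁻¹, by simp⟩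

/-- Cyclic reduction of the words that begin and end with a power of `b`. -/
theorem exists_isConj_mul_positiveWord (h : IsFreePair a b E ν) (n : ℕ) (l : List E)
    (hln : l.length ≤ n) :
    (∃ q : List E, IsConj (positiveWord a b q) (a * positiveWord a b l) ∧
      weight q + 1 ≤ weight l) ∨
      IsConj a (a * positiveWord a b l) ∨ ∃ z : ℤ, IsConj (b ^ z) (a * positiveWord a b l) := by
  induction n generalizing l with
  | zero =>
    obtain rfl : l = [] := List.length_eq_zero_iff.1 (by omega)
    right; left; rw [positiveWord_nil, mul_one]
  | succ n ih =>
    rcases l with _ | ⟨x, l⟩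
    · right; left; rw [positiveWord_nil, mul_one]
    rcases List.eq_nil_or_concat l with rfl | ⟨l, y, rfl⟩
    · right; right
      exact ⟨x, by rw [positiveWord_cons, positiveWord_nil, mul_one, h.a_mul_a_mul]⟩
    simp only [List.concat_eq_append, List.length_cons, List.length_append,
      List.length_nil] at hln ⊢
    have h1 : IsConj (b ^ (y + x : ℤ) * positiveWord a b l * a)
        (a * positiveWord a b (x :: (l ++ [y]))) :=
      isConj_iff.2 ⟨(b ^ (y : ℤ))⁻¹, by
        simp only [positiveWord_cons, positiveWord_append, mul_assoc, h.a_mul_a_mul, zpow_add]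
        simp⟩
    rcases h.zpow_mul_positiveWord (y + x) l with h2 | ⟨z, hz, h2⟩
    · rw [h2] at h1
      have h3 : IsConj (a * positiveWord a b l) (positiveWord a b l * a) :=
        isConj_iff.2 ⟨a, by simp [h.a_mul_a_mul, h.inv_a]⟩
      rcases ih l (by omega) with ⟨q, hq, hqw⟩ | h4 | ⟨z, h4⟩
      · refine .inl ⟨q, hq.trans (h3.trans h1), ?_⟩
        simp; omega
      · exact .inr (.inl (h4.trans (h3.trans h1)))
      · exact .inr (.inr ⟨z, h4.trans (h3.trans h1)⟩)
    · rw [h2] at h1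
      refine .inl ⟨z :: l, IsConj.trans (isConj_iff.2 ⟨a, ?_⟩) h1, ?_⟩
      · rw [h.inv_a]
      · simp; omega

/-- Every word is conjugate to a positive word that is not longer, or to `a`, or to a power
of `b`. -/
theorem exists_isConj_of_word (h : IsFreePair a b E ν) (w : List G)
    (hw : ∀ x ∈ w, x = a ∨ x = b ∨ x = b⁻¹) :
    (∃ q : List E, IsConj (positiveWord a b q) w.prod ∧ weight q ≤ w.length) ∨
      IsConj a w.prod ∨ ∃ z : ℤ, IsConj (b ^ z) w.prod := by
  obtain ⟨l, ⟨hp, hn⟩ | ⟨hp, hne, hn⟩ | ⟨hp, hn⟩ | ⟨hp, hne, hn⟩⟩ := h.exists_normalForm w hw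
  · exact .inl ⟨l, by rw [hp], hn⟩
  · rw [hp]
    rcases h.exists_isConj_mul_positiveWord l.length l le_rfl with ⟨q, hq, hqw⟩ | h4
    · exact .inl ⟨q, hq, by omega⟩
    · exact .inr h4
  · rw [hp]
    have h3 : IsConj (a * positiveWord a b l) (positiveWord a b l * a) :=
      isConj_iff.2 ⟨a, by simp [h.a_mul_a_mul, h.inv_a]⟩
    rcases h.exists_isConj_mul_positiveWord l.length l le_rfl with ⟨q, hq, hqw⟩ | h4 | ⟨z, h4⟩
    · exact .inl ⟨q, hq.trans h3, by omega⟩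
    · exact .inr (.inl (h4.trans h3))
    · exact .inr (.inr ⟨z, h4.trans h3⟩)
  · exact .inl ⟨l, isConj_iff.2 ⟨a, by rw [hp, h.inv_a]⟩, hn⟩

theorem exists_isConj (h : IsFreePair a b E ν) (g : G) :
    (∃ q : List E, IsConj (positiveWord a b q) g) ∨ IsConj a g ∨ ∃ z : ℤ, IsConj (b ^ z) g := by
  obtain ⟨w, hw, rfl⟩ := h.exists_word g
  rcases h.exists_isConj_of_word w hw with ⟨q, hq, -⟩ | h1
  · exact .inl ⟨q, hq⟩
  · exact .inr h1

/-- Two lists intertwined by a third one are rotations of each other. -/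
theorem isRotated_of_append_eq_append {α : Type*} (n : ℕ) (l p p' : List α) (hn : l.length ≤ n)
    (h1 : l ++ p = p' ++ l) : p ~r p' := by
  induction n generalizing l with
  | zero =>
    obtain rfl : l = [] := List.length_eq_zero_iff.1 (by omega)
    simp at h1
    rw [h1]
  | succ n ih =>
    rcases List.append_eq_append_iff.1 h1 with ⟨m, rfl, rfl⟩ | ⟨m, h2, h3⟩
    · exact List.isRotated_append
    · rcases p' with _ | ⟨x, p'⟩
      · simp_all
      refine ih m ?_ (h3.symm.trans h2)
      have := congrArg List.length h2
      simp at this hn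
      omega

/-- Conjugate positive words are rotations of each other. -/
theorem isRotated_of_isConj (h : IsFreePair a b E ν) {p p' : List E}
    (hc : IsConj (positiveWord a b p) (positiveWord a b p')) : p ~r p' := by
  obtain ⟨g, hg⟩ := isConj_iff.1 hc
  have hg : g * positiveWord a b p = positiveWord a b p' * g := by
    rw [← hg]; simp
  have intertwine : ∀ l q q' : List E, positiveWord a b l * positiveWord a b q =
      positiveWord a b q' * positiveWord a b l → q ~r q' := fun l q q' h1 =>
    isRotated_of_append_eq_append _ l q q' le_rfl
      (h.positiveWord_injective (by simpa using h1))
  obtain ⟨l, rfl | rfl | rfl | rfl⟩ := h.exists_positiveWord_eq g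
  · exact intertwine l p p' hg
  · -- here `p` and `p'` would have to be empty
    have h1 : positiveWord a b (flipWord ν p ++ flipWord ν l ++ p') =
        positiveWord a b (flipWord ν l) := by
      rw [h.mul_positiveWord, mul_assoc, h.mul_positiveWord, ← mul_assoc, ← mul_assoc,
        mul_left_inj, ← mul_inv_rev, eq_mul_inv_iff_mul_eq, inv_mul_eq_iff_eq_mul] at hg
      simpa [mul_assoc] using hg.symm
    have h2 := congrArg List.length (h.positiveWord_injective h1)
    simp only [List.length_append, length_flipWord] at h2
    rw [List.length_eq_zero_iff.1 (by omega : p.length = 0),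
      List.length_eq_zero_iff.1 (by omega : p'.length = 0)]
  · have h1 : positiveWord a b (p' ++ l ++ flipWord ν p) = positiveWord a b l := by
      rw [mul_assoc, h.mul_positiveWord, ← mul_assoc, ← mul_assoc, mul_left_inj,
        mul_inv_eq_iff_eq_mul] at hg
      simpa [mul_assoc] using hg.symm
    have h2 := congrArg List.length (h.positiveWord_injective h1)
    simp only [List.length_append, length_flipWord] at h2
    rw [List.length_eq_zero_iff.1 (by omega : p.length = 0),
      List.length_eq_zero_iff.1 (by omega : p'.length = 0)]
  · rw [← h.inv_positiveWord_flipWord, eq_mul_inv_iff_mul_eq, mul_assoc,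
      inv_mul_eq_iff_eq_mul] at hg
    exact (intertwine _ _ _ hg.symm).symm

/-- A positive word with at least one letter is not conjugate to a power of `b`. -/
theorem not_isConj_zpow (h : IsFreePair a b E ν) {p : List E} (hp : p ≠ []) (z : ℤ) :
    ¬ IsConj (b ^ z) (positiveWord a b p) := by
  intro hc
  rcases h.zpow_eq z with hz | ⟨y, hy, -⟩
  · rw [hz, isConj_one_right] at hc
    exact h.positiveWord_ne_one hp hc
  rw [hy] at hc
  obtain ⟨g, hg⟩ := isConj_iff.1 hc.symm
  replace hg : g * positiveWord a b p = b ^ (y : ℤ) * g := by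
    rw [← hg]; simp
  have hy : b ^ (y : ℤ) = a * positiveWord a b [y] := by simp [h.a_mul_a_mul]
  have case1 : ∀ l : List E,
      positiveWord a b l * positiveWord a b p ≠ b ^ (y : ℤ) * positiveWord a b l := by
    intro l h1
    apply h.mul_positiveWord_ne (y :: l) (l ++ p)
    rw [positiveWord_append, h1, hy, mul_assoc]
    simp [mul_assoc]
  have case2 : ∀ l : List E,
      positiveWord a b l * a * positiveWord a b p ≠ b ^ (y : ℤ) * (positiveWord a b l * a) := by
    intro l h1
    rw [mul_assoc, h.mul_positiveWord, ← mul_assoc, ← mul_assoc, mul_left_inj,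
      mul_inv_eq_iff_eq_mul] at h1
    apply h.mul_positiveWord_ne (y :: (l ++ flipWord ν p)) l
    rw [h1, hy]
    simp [mul_assoc]
  obtain ⟨l, rfl | rfl | rfl | rfl⟩ := h.exists_positiveWord_eq g
  · exact case1 l hg
  · rcases l with _ | ⟨x, l⟩
    · exact case2 [] (by simpa using hg)
    -- the leading power of `b` commutes with `b ^ y`
    · apply case1 l
      apply mul_left_cancel (a := b ^ (x : ℤ))
      rw [← mul_assoc (b ^ (x : ℤ)) (b ^ (y : ℤ)), ← zpow_add, add_comm, zpow_add]
      simpa only [positiveWord_cons, mul_assoc, h.a_mul_a_mul] using hg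
  · exact case2 l hg
  · rcases l with _ | ⟨x, l⟩
    · exact case1 [] (by simpa [h.a_mul_a] using hg)
    · apply case2 l
      apply mul_left_cancel (a := b ^ (x : ℤ))
      rw [← mul_assoc (b ^ (x : ℤ)) (b ^ (y : ℤ)), ← zpow_add, add_comm, zpow_add]
      simpa only [positiveWord_cons, mul_assoc, h.a_mul_a_mul] using hg

theorem not_isConj_a (h : IsFreePair a b E ν) {p : List E} (hp : p ≠ []) :
    ¬ IsConj a (positiveWord a b p) := by
  intro hc
  have h1 := hc.pow 2
  rw [pow_two, h.a_mul_a, isConj_one_right, pow_two, ← positiveWord_append] at h1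
  exact h.positiveWord_ne_one (by simp [hp]) h1

/-! ### Word lengths -/

theorem exists_word_of_positiveWord (h : IsFreePair a b E ν) (p : List E) :
    ∃ w : List G, (∀ x ∈ w, x = a ∨ x = b ∨ x = b⁻¹) ∧ w.prod = positiveWord a b p ∧
      w.length = weight p := by
  induction p with
  | nil => exact ⟨[], by simp⟩
  | cons x p ih =>
    obtain ⟨w, hw, hp, hl⟩ := ih
    obtain ⟨e, he, hx⟩ : ∃ e : G, (e = b ∨ e = b⁻¹) ∧ e ^ (x : ℤ).natAbs = b ^ (x : ℤ) := by
      rcases Int.natAbs_eq (x : ℤ) with h1 | h1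
      · exact ⟨b, .inl rfl, by conv_rhs => rw [h1, zpow_natCast]⟩
      · exact ⟨b⁻¹, .inr rfl, by conv_rhs => rw [h1, zpow_neg, zpow_natCast, ← inv_pow]⟩
    refine ⟨a :: (List.replicate (x : ℤ).natAbs e ++ w), ?_, ?_, ?_⟩
    · intro y hy
      simp only [List.mem_cons, List.mem_append, List.mem_replicate] at hy
      rcases hy with rfl | ⟨-, rfl⟩ | hy
      · exact .inl rfl
      · exact .inr he
      · exact hw y hy
    · simp [hp, hx, mul_assoc]
    · simp [hl]; omega

theorem wordLength_positiveWord_le (h : IsFreePair a b E ν) (p : List E) :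
    wordLength a b (positiveWord a b p) ≤ weight p :=
  Nat.sInf_le (h.exists_word_of_positiveWord p)

/-- Positive words are cyclically reduced: none of their conjugates is shorter. -/
theorem weight_le_wordLength (h : IsFreePair a b E ν) {p : List E} (hp : p ≠ []) {g : G}
    (hg : IsConj (positiveWord a b p) g) : weight p ≤ wordLength a b g := by
  obtain ⟨w, hw, hwg⟩ := h.exists_word g
  obtain ⟨w, hw, rfl, hwl⟩ := Nat.sInf_mem (s := {n : ℕ | ∃ l : List G,
    (∀ x ∈ l, x = a ∨ x = b ∨ x = b⁻¹) ∧ l.prod = g ∧ l.length = n}) ⟨_, w, hw, hwg, rfl⟩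
  rw [wordLength, ← hwl]
  rcases h.exists_isConj_of_word w hw with ⟨q, hq, hqw⟩ | h1 | ⟨z, h1⟩
  · rwa [weight_eq_of_perm (h.isRotated_of_isConj (hg.trans hq.symm)).perm]
  · exact absurd (h1.trans hg.symm) (h.not_isConj_a hp)
  · exact absurd (h1.trans hg.symm) (h.not_isConj_zpow hp z)

theorem wordLength_positiveWord (h : IsFreePair a b E ν) {p : List E} (hp : p ≠ []) :
    wordLength a b (positiveWord a b p) = weight p :=
  le_antisymm (h.wordLength_positiveWord_le p) (h.weight_le_wordLength hp (IsConj.refl _))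

theorem classLength_positiveWord (h : IsFreePair a b E ν) {p : List E} (hp : p ≠ []) :
    classLength a b (ConjClasses.mk (positiveWord a b p)) = weight p := by
  have hm : positiveWord a b p ∈ (ConjClasses.mk (positiveWord a b p)).carrier :=
    ConjClasses.mem_carrier_mk
  apply le_antisymm
  · exact Nat.sInf_le ⟨_, hm, h.wordLength_positiveWord hp⟩
  · obtain ⟨g, hg, hgl⟩ := Nat.sInf_mem (s := {n : ℕ | ∃ g ∈
      (ConjClasses.mk (positiveWord a b p)).carrier, wordLength a b g = n}) ⟨_, _, hm, rfl⟩
    rw [classLength, ← hgl]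
    exact h.weight_le_wordLength hp (ConjClasses.mk_eq_mk_iff_isConj.1
      (ConjClasses.mem_carrier_iff_mk_eq.1 hg).symm)

end IsFreePair

end PositiveWords

/-! ### Powers, rotations and palindromes of lists -/

section ListPowers

theorem List.rotate_flatten_replicate {α : Type*} (q : List α) (r n : ℕ) :
    ((List.replicate r q).flatten).rotate n = (List.replicate r (q.rotate n)).flatten := by
  induction n with
  | zero => simp
  | succ n ih =>
    rw [← List.rotate_rotate, ih, ← List.rotate_rotate]
    generalize q.rotate n = q
    rcases q with _ | ⟨x, q⟩
    · simp
    have h1 : ∀ r : ℕ, (List.replicate r (x :: q)).flatten ++ [x] =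
        x :: (List.replicate r (q ++ [x])).flatten := by
      intro r
      induction r with
      | zero => simp
      | succ r ih => simp [List.replicate_succ, ih]
    rcases r with _ | r
    · simp
    · simp [List.replicate_succ, h1]

variable {E : Set ℤ} {ν : E → E}

theorem weight_flatten_replicate (u : List E) (r : ℕ) :
    weight (List.replicate r u).flatten = r * weight u := by
  induction r with
  | zero => simp
  | succ r ih => simp [List.replicate_succ, ih]; ring

theorem flipWord_flatten_replicate (u : List E) (r : ℕ) :
    flipWord ν (List.replicate r u).flatten = (List.replicate r (flipWord ν u)).flatten := by
  induction r with
  | zero => simp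
  | succ r ih =>
    rw [List.replicate_succ, List.flatten_cons, flipWord_append, ih, List.replicate_succ',
      List.flatten_append]
    simp

/-- A list fixed by the flip is one half, followed by a middle letter fixed by `ν` if the length
is odd, followed by the flip of the half. -/
theorem exists_eq_append_flipWord (u : List E) (hu : flipWord ν u = u) :
    ∃ v o : List E, u = v ++ o ++ flipWord ν v ∧ (o = [] ∨ ∃ x, ν x = x ∧ o = [x]) := by
  induction u using List.bidirectionalRec with
  | nil => exact ⟨[], [], by simp⟩
  | singleton x => exact ⟨[], [x], by simp, .inr ⟨x, by simpa using hu, rfl⟩⟩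
  | cons_append x u y ih =>
    simp only [flipWord_cons, flipWord_append, flipWord_nil, List.nil_append, List.cons_append,
      List.cons.injEq] at hu
    obtain ⟨h1, h2⟩ := hu
    obtain ⟨h2, h3⟩ := List.append_inj h2 (by simp)
    obtain ⟨v, o, hv, ho⟩ := ih h2
    refine ⟨x :: v, o, ?_, ho⟩
    rw [hv]
    simp only [List.cons.injEq, and_true] at h3
    simp [h3]

/-- Among the rotations of a list `p` fixed by the flip, at most two are fixed by the flip. -/
theorem eq_or_eq_or_eq_of_isRotated {p p₁ p₂ : List E} (h1 : p ~r p₁) (h2 : p ~r p₂)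
    (hp : flipWord ν p = p) (hp1 : flipWord ν p₁ = p₁) (hp2 : flipWord ν p₂ = p₂) :
    p = p₁ ∨ p = p₂ ∨ p₁ = p₂ := by
  have iter : ∀ n : ℕ, (fun l : List E => l.rotate 1)^[n] p = p.rotate n := by
    intro n
    induction n with
    | zero => simp
    | succ n ih => rw [Function.iterate_succ_apply', ih, List.rotate_rotate]
  set d := Function.minimalPeriod (fun l : List E => l.rotate 1) p with hd
  have dvd : ∀ n : ℕ, p.rotate n = p ↔ d ∣ n := by
    intro n
    rw [hd, ← Function.isPeriodicPt_iff_minimalPeriod_dvd, Function.IsPeriodicPt,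
      Function.IsFixedPt, iter]
  have hmod : ∀ n : ℕ, p.rotate (n % d) = p.rotate n := by
    intro n
    rw [← iter, ← iter, Function.iterate_mod_minimalPeriod_eq]
  -- a rotation by `n` fixed by the flip is also the rotation by `-n`
  have two : ∀ n : ℕ, flipWord ν (p.rotate n) = p.rotate n → d ∣ 2 * n := by
    intro n hn
    rw [← dvd, two_mul, ← List.rotate_rotate]
    rw [flipWord, List.map_rotate, List.reverse_rotate] at hn
    change (flipWord ν p).rotate _ = _ at hn
    rw [hp] at hn
    rw [← hn, List.rotate_rotate, List.length_map]
    rcases Nat.eq_zero_or_pos p.length with h0 | h0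
    · rw [List.length_eq_zero_iff] at h0
      simp [h0]
    · have h3 : p.length - n % p.length + n = p.length * (1 + n / p.length) := by
        have h4 := Nat.div_add_mod n p.length
        have h5 := Nat.mod_lt n h0
        rw [mul_add, mul_one]
        omega
      rw [h3, List.rotate_length_mul]
  obtain ⟨n1, rfl⟩ := h1
  obtain ⟨n2, rfl⟩ := h2
  have t1 := two n1 hp1
  have t2 := two n2 hp2
  by_cases e1 : d ∣ n1
  · exact .inl ((dvd n1).2 e1).symm
  by_cases e2 : d ∣ n2
  · exact .inr (.inl ((dvd n2).2 e2).symm)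
  right; right
  have half : ∀ n : ℕ, d ∣ 2 * n → ¬ d ∣ n → 2 * (n % d) = d := by
    intro n h1 h2
    have h3 : d ∣ 2 * (n % d) := by
      rw [Nat.dvd_iff_mod_eq_zero, Nat.mul_mod_mod, ← Nat.dvd_iff_mod_eq_zero]
      exact h1
    have h4 : n % d ≠ 0 := fun h => h2 (Nat.dvd_of_mod_eq_zero h)
    have hd0 : 0 < d := by
      rcases Nat.eq_zero_or_pos d with h0 | h0
      · rw [h0] at h1 h2
        simp at h1 h2
        exact absurd h1 h2
      · exact h0
    have h5 := Nat.mod_lt n hd0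
    obtain ⟨k, hk⟩ := h3
    have : k = 1 := by
      rcases k with _ | _ | k
      · omega
      · rfl
      · nlinarith
    rw [hk, this, mul_one]
  rw [← hmod n1, ← hmod n2]
  congr 1
  have := half n1 t1 e1
  have := half n2 t2 e2
  omega

end ListPowers

namespace IsFreePair

variable {G : Type*} [Group G] {a b : G} {E : Set ℤ} {ν : E → E}

/-! ### Counting words by weight -/

theorem _root_.finite_setOf_weight_eq (E : Set ℤ) (t : ℕ) : {l : List E | weight l = t}.Finite := by
  induction t using Nat.strong_induction_on with
  | _ t ih =>
    have hS : ∀ j : ℕ, {x : E | (x : ℤ).natAbs = j}.Finite := fun j =>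
      Set.Finite.of_finite_image (f := Subtype.val) ((Set.finite_Icc (-(j : ℤ)) j).subset (by
        rintro _ ⟨x, hx, rfl⟩
        simp only [Set.mem_ofPred_eq] at hx
        simp only [Set.mem_Icc]; omega)) Subtype.val_injective.injOn
    apply Set.Finite.subset (s := {[]} ∪ ⋃ j ∈ Finset.range t,
      Set.image2 List.cons {x : E | (x : ℤ).natAbs = j} {l : List E | weight l = t - 1 - j})
    · refine (Set.finite_singleton _).union (Set.Finite.biUnion (Finset.finite_toSet _) ?_)
      intro j hj
      simp only [Finset.coe_range, Set.mem_Iio] at hj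
      exact (hS j).image2 _ (ih _ (by omega))
    · rintro (_ | ⟨x, l⟩) hl
      · simp
      · simp only [Set.mem_ofPred_eq, weight_cons] at hl
        right
        simp only [Set.mem_iUnion, Finset.mem_range]
        exact ⟨(x : ℤ).natAbs, by omega, x, rfl, l, by simp only [Set.mem_ofPred_eq]; omega, rfl⟩

/-- The reciprocal class attached to a word: that of `l` followed by its flip. -/
def _root_.reciprocalClass (a b : G) (ν : E → E) (l : List E) : ConjClasses G :=
  ConjClasses.mk (positiveWord a b (l ++ flipWord ν l))

theorem flipWord_append_flipWord (h : IsFreePair a b E ν) (l : List E) :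
    flipWord ν (l ++ flipWord ν l) = l ++ flipWord ν l := by
  rw [flipWord_append, h.flipWord_flipWord]

theorem reciprocalClass_flipWord (h : IsFreePair a b E ν) (l : List E) :
    reciprocalClass a b ν (flipWord ν l) = reciprocalClass a b ν l := by
  rw [reciprocalClass, reciprocalClass, ConjClasses.mk_eq_mk_iff_isConj, h.flipWord_flipWord]
  exact isConj_positiveWord_append_comm _ _

theorem append_flipWord_injective : Function.Injective fun l : List E => l ++ flipWord ν l := by
  intro l l' hl
  have h1 := congrArg List.length hl
  simp only [List.length_append, length_flipWord] at h1
  exact (List.append_inj hl (by omega)).1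

theorem eq_or_eq_or_eq_of_reciprocalClass (h : IsFreePair a b E ν) {l l₁ l₂ : List E}
    (h1 : reciprocalClass a b ν l = reciprocalClass a b ν l₁)
    (h2 : reciprocalClass a b ν l = reciprocalClass a b ν l₂) : l = l₁ ∨ l = l₂ ∨ l₁ = l₂ := by
  have := eq_or_eq_or_eq_of_isRotated
    (h.isRotated_of_isConj (ConjClasses.mk_eq_mk_iff_isConj.1 h1))
    (h.isRotated_of_isConj (ConjClasses.mk_eq_mk_iff_isConj.1 h2))
    (h.flipWord_append_flipWord l) (h.flipWord_append_flipWord l₁) (h.flipWord_append_flipWord l₂)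
  rcases this with h3 | h3 | h3
  · exact .inl (append_flipWord_injective h3)
  · exact .inr (.inl (append_flipWord_injective h3))
  · exact .inr (.inr (append_flipWord_injective h3))

theorem positiveWord_flatten_replicate (u : List E) (r : ℕ) :
    positiveWord a b (List.replicate r u).flatten = positiveWord a b u ^ r := by
  induction r with
  | zero => simp
  | succ r ih => rw [List.replicate_succ, List.flatten_cons, positiveWord_append, ih, pow_succ']

/-- If the element attached to `l` is a proper power, then its cyclic word is a proper power of a
word fixed by the flip. -/
theorem exists_eq_flatten_replicate (h : IsFreePair a b E ν) {l : List E} (hl : l ≠ [])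
    (hn : ¬ IsPrimitiveElement (positiveWord a b (l ++ flipWord ν l))) :
    ∃ (r : ℕ) (u : List E), 2 ≤ r ∧ flipWord ν u = u ∧
      l ++ flipWord ν l = (List.replicate r u).flatten := by
  simp only [IsPrimitiveElement, not_forall] at hn
  obtain ⟨g, r, hgr, hr⟩ := hn
  have hne : l ++ flipWord ν l ≠ [] := by simp [hl]
  have hr0 : r ≠ 0 := by
    rintro rfl
    exact h.positiveWord_ne_one hne (by rw [← hgr, pow_zero])
  rcases h.exists_isConj g with ⟨q, hq⟩ | hq | ⟨z, hq⟩
  · have h1 := hq.pow r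
    rw [hgr, ← positiveWord_flatten_replicate] at h1
    obtain ⟨n, hn⟩ := h.isRotated_of_isConj h1
    rw [List.rotate_flatten_replicate] at hn
    refine ⟨r, q.rotate n, by omega, ?_, hn.symm⟩
    have h2 := h.flipWord_append_flipWord l
    rw [← hn, flipWord_flatten_replicate] at h2
    obtain ⟨s, rfl⟩ := Nat.exists_eq_succ_of_ne_zero hr0
    rw [List.replicate_succ, List.replicate_succ, List.flatten_cons, List.flatten_cons] at h2
    exact (List.append_inj h2 (by simp)).1
  · have h1 := hq.pow r
    rw [hgr] at h1
    rcases Nat.even_or_odd' r with ⟨s, rfl | rfl⟩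
    · rw [pow_mul, pow_two, h.a_mul_a, one_pow, isConj_one_right] at h1
      exact absurd h1 (h.positiveWord_ne_one hne)
    · rw [pow_succ, pow_mul, pow_two, h.a_mul_a, one_pow, one_mul] at h1
      exact absurd h1 (h.not_isConj_a hne)
  · have h1 := hq.pow r
    rw [hgr, ← zpow_natCast, ← zpow_mul] at h1
    exact absurd h1 (h.not_isConj_zpow hne _)

theorem not_isPrimitiveElement_of_flipWord_eq {l : List E} (hl : flipWord ν l = l) :
    ¬ IsPrimitiveElement (positiveWord a b (l ++ flipWord ν l)) := by
  intro hp
  have := hp (positiveWord a b l) 2 (by rw [hl, positiveWord_append, pow_two])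
  omega

end IsFreePair

/-! ### Asymptotic counting of reciprocal classes -/

/-- The words of weight `t`. -/
def wordsOfWeight (E : Set ℤ) (t : ℕ) : Finset (List E) :=
  (finite_setOf_weight_eq E t).toFinset

@[simp] theorem mem_wordsOfWeight {E : Set ℤ} {t : ℕ} {l : List E} :
    l ∈ wordsOfWeight E t ↔ weight l = t := by
  simp [wordsOfWeight]

namespace IsFreePair

variable {G : Type*} [Group G] {a b : G} {E : Set ℤ} {ν : E → E}

open Classical in
/-- The words of weight `t` whose attached element is not primitive. -/
def imprimitiveWords (a b : G) (ν : E → E) (t : ℕ) : Finset (List E) :=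
  (wordsOfWeight E t).filter fun l => ¬ IsPrimitiveElement (positiveWord a b (l ++ flipWord ν l))

open Classical in
theorem card_wordsOfWeight_le (h : IsFreePair a b E ν) (t : ℕ) :
    (wordsOfWeight E t).card ≤
      2 * ((wordsOfWeight E t).image (reciprocalClass a b ν)).card := by
  refine Finset.card_le_mul_card_image _ _ fun γ _ => ?_
  by_contra! hlt
  obtain ⟨l, hl, l₁, h1, l₂, h2, h3, h4, h5⟩ := Finset.two_lt_card.1 hlt
  simp only [Finset.mem_filter] at hl h1 h2
  rcases h.eq_or_eq_or_eq_of_reciprocalClass (hl.2.trans h1.2.symm) (hl.2.trans h2.2.symm)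
    with h6 | h6 | h6 <;> contradiction

open Classical in
/-- A class is attached to the two words `l` and `flipWord ν l`, unless they are equal, and in that
case the class is not primitive. -/
theorem two_mul_card_image_le (h : IsFreePair a b E ν) (t : ℕ) :
    2 * ((wordsOfWeight E t).image (reciprocalClass a b ν)).card ≤
      (wordsOfWeight E t).card + (imprimitiveWords a b ν t).card := by
  rw [Finset.card_eq_sum_card_image (reciprocalClass a b ν) (wordsOfWeight E t),
    Finset.card_eq_sum_card_fiberwise (s := imprimitiveWords a b ν t)
      (t := (wordsOfWeight E t).image (reciprocalClass a b ν)) (f := reciprocalClass a b ν)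
      (fun l hl => Finset.mem_image_of_mem _ (Finset.mem_filter.1 hl).1),
    ← Finset.sum_add_distrib, mul_comm, ← smul_eq_mul, ← Finset.sum_const]
  refine Finset.sum_le_sum fun γ hγ => ?_
  obtain ⟨l, hl, rfl⟩ := Finset.mem_image.1 hγ
  by_cases hfl : flipWord ν l = l
  · have h1 : l ∈ (wordsOfWeight E t).filter
        fun l' => reciprocalClass a b ν l' = reciprocalClass a b ν l :=
      Finset.mem_filter.2 ⟨hl, rfl⟩
    have h2 : l ∈ (imprimitiveWords a b ν t).filter
        fun l' => reciprocalClass a b ν l' = reciprocalClass a b ν l :=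
      Finset.mem_filter.2 ⟨Finset.mem_filter.2 ⟨hl, not_isPrimitiveElement_of_flipWord_eq hfl⟩, rfl⟩
    have := Finset.card_pos.2 ⟨_, h1⟩
    have := Finset.card_pos.2 ⟨_, h2⟩
    omega
  · refine le_add_right (Finset.one_lt_card.2 ⟨l, Finset.mem_filter.2 ⟨hl, rfl⟩, flipWord ν l,
      Finset.mem_filter.2 ⟨?_, h.reciprocalClass_flipWord l⟩, fun h1 => hfl h1.symm⟩)
    rw [mem_wordsOfWeight] at hl ⊢
    rw [h.weight_flipWord, hl]

/-- An imprimitive word of weight `t` is the first half of a power of a word `v ++ o ++ flip v`,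
where `v` has weight at most `t / 2` and `o` is empty or a letter fixed by `ν`. -/
theorem card_imprimitiveWords_le (h : IsFreePair a b E ν) (hfix : {x : E | ν x = x}.Finite) :
    ∃ C : ℕ, ∀ t : ℕ, 1 ≤ t → (imprimitiveWords a b ν t).card ≤
      C * (2 * t + 1) * ∑ s ∈ Finset.range (t / 2 + 1), (wordsOfWeight E s).card := by
  classical
  set O : Finset (List E) := insert [] (hfix.toFinset.image fun x => [x]) with hO
  refine ⟨O.card, fun t ht => ?_⟩
  set V : Finset (List E) := (Finset.range (t / 2 + 1)).biUnion (wordsOfWeight E) with hV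
  have hsub : imprimitiveWords a b ν t ⊆ ((O ×ˢ Finset.range (2 * t + 1)) ×ˢ V).image fun x =>
      let p := (List.replicate x.1.2 (x.2 ++ x.1.1 ++ flipWord ν x.2)).flatten
      p.take (p.length / 2) := by
    intro l hl
    simp only [imprimitiveWords, Finset.mem_filter, mem_wordsOfWeight] at hl
    obtain ⟨hlt, hl⟩ := hl
    have hne : l ≠ [] := by
      rintro rfl
      simp at hlt
      omega
    obtain ⟨r, u, hr, hu, hp⟩ := h.exists_eq_flatten_replicate hne hl
    obtain ⟨v, o, rfl, ho⟩ := exists_eq_append_flipWord u hu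
    have hw := congrArg weight hp
    rw [weight_flatten_replicate, weight_append, h.weight_flipWord, hlt] at hw
    have hw' : 1 ≤ weight (v ++ o ++ flipWord ν v) := by
      rcases Nat.eq_zero_or_pos (weight (v ++ o ++ flipWord ν v)) with h0 | h0
      · rw [h0] at hw; omega
      · exact h0
    refine Finset.mem_image.2 ⟨((o, r), v), ?_, ?_⟩
    · simp only [Finset.mem_product, Finset.mem_range, hO, hV, Finset.mem_insert, Finset.mem_image,
        Set.Finite.mem_toFinset, Set.mem_ofPred_eq, Finset.mem_biUnion, mem_wordsOfWeight]
      refine ⟨⟨?_, ?_⟩, weight v, ?_, rfl⟩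
      · rcases ho with ho | ⟨x, hx, ho⟩
        · exact .inl ho
        · exact .inr ⟨x, hx, ho.symm⟩
      · nlinarith
      · have h1 : weight (v ++ o ++ flipWord ν v) ≤ t := by nlinarith
        simp only [weight_append, h.weight_flipWord] at h1
        omega
    · simp only [← hp, List.length_append, length_flipWord]
      rw [← two_mul, Nat.mul_div_cancel_left _ two_pos, List.take_left]
  calc (imprimitiveWords a b ν t).card ≤ _ := Finset.card_le_card hsub
    _ ≤ ((O ×ˢ Finset.range (2 * t + 1)) ×ˢ V).card := Finset.card_image_le
    _ = O.card * (2 * t + 1) * V.card := by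
      rw [Finset.card_product, Finset.card_product, Finset.card_range]
    _ ≤ _ := Nat.mul_le_mul_left _ Finset.card_biUnion_le

open Filter Topology in
/-- If the number of words of weight `t` grows like `ρ ^ t`, then imprimitive words are
negligible. -/
theorem tendsto_card_imprimitiveWords (h : IsFreePair a b E ν) (hfix : {x : E | ν x = x}.Finite)
    {ρ c : ℝ} (hρ : 1 < ρ)
    (hc : Tendsto (fun t : ℕ => ((wordsOfWeight E t).card : ℝ) / ρ ^ t) atTop (𝓝 c)) :
    Tendsto (fun t : ℕ => ((imprimitiveWords a b ν t).card : ℝ) / ρ ^ t) atTop (𝓝 0) := by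
  obtain ⟨C, hC⟩ := h.card_imprimitiveWords_le hfix
  obtain ⟨D, hD⟩ := hc.bddAbove_range
  have hρ0 : 0 < ρ := by linarith
  have hD' : ∀ s : ℕ, ((wordsOfWeight E s).card : ℝ) ≤ D * ρ ^ s := fun s => by
    rw [← div_le_iff₀ (by positivity)]
    exact hD ⟨s, rfl⟩
  have hD0 : 0 ≤ D := le_trans (by positivity) (hD ⟨0, rfl⟩)
  obtain ⟨σ, hσ1, hσ2⟩ : ∃ σ : ℝ, 1 < σ ∧ σ ^ 2 = ρ :=
    ⟨Real.sqrt ρ, Real.lt_sqrt_of_sq_lt (by simpa using hρ), Real.sq_sqrt hρ0.le⟩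
  have hσ0 : 0 < σ := by linarith
  have bound : ∀ t : ℕ, 1 ≤ t → ((imprimitiveWords a b ν t).card : ℝ) / ρ ^ t ≤
      (6 * C * D) * ((t : ℝ) ^ 2 / σ ^ t) := by
    intro t ht
    have ht' : (1 : ℝ) ≤ t := by exact_mod_cast ht
    have h1 : ∑ s ∈ Finset.range (t / 2 + 1), ((wordsOfWeight E s).card : ℝ) ≤
        (2 * t) * (D * σ ^ t) := by
      calc ∑ s ∈ Finset.range (t / 2 + 1), ((wordsOfWeight E s).card : ℝ)
          ≤ ∑ s ∈ Finset.range (t / 2 + 1), D * σ ^ t := by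
            refine Finset.sum_le_sum fun s hs => (hD' s).trans ?_
            rw [← hσ2, ← pow_mul]
            have := Finset.mem_range.1 hs
            gcongr
            · exact hσ1.le
            · omega
        _ = ((t / 2 + 1 : ℕ) : ℝ) * (D * σ ^ t) := by simp
        _ ≤ (2 * t) * (D * σ ^ t) := by
            gcongr
            have : t / 2 + 1 ≤ 2 * t := by omega
            exact_mod_cast this
    have h2 : ((imprimitiveWords a b ν t).card : ℝ) ≤
        C * (3 * t) * ((2 * t) * (D * σ ^ t)) := by
      calc ((imprimitiveWords a b ν t).card : ℝ)
          ≤ C * (2 * t + 1) * ∑ s ∈ Finset.range (t / 2 + 1), ((wordsOfWeight E s).card : ℝ) := by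
            exact_mod_cast hC t ht
        _ ≤ C * (3 * t) * ((2 * t) * (D * σ ^ t)) := by
            gcongr
            linarith
    rw [div_le_iff₀ (by positivity)]
    refine h2.trans (le_of_eq ?_)
    have h3 : ρ ^ t = σ ^ t * σ ^ t := by rw [← hσ2, ← pow_mul, two_mul, pow_add]
    rw [h3]
    field_simp
    ring
  have hlim : Tendsto (fun t : ℕ => (6 * C * D) * ((t : ℝ) ^ 2 / σ ^ t)) atTop (𝓝 0) := by
    simpa using (tendsto_pow_const_div_const_pow_of_one_lt 2 hσ1).const_mul (6 * C * D)
  refine squeeze_zero' (Eventually.of_forall fun t => by positivity) ?_ hlim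
  filter_upwards [eventually_ge_atTop 1] with t ht using bound t ht

open Filter Topology in
/-- Up to negligible exceptions a class is attached to exactly two words and is primitive, so all
classes and the primitive ones grow like half the number of words. -/
theorem tendsto_ncard_reciprocalClass (h : IsFreePair a b E ν) (hfix : {x : E | ν x = x}.Finite)
    {ρ c : ℝ} (hρ : 1 < ρ)
    (hc : Tendsto (fun t : ℕ => ((wordsOfWeight E t).card : ℝ) / ρ ^ t) atTop (𝓝 c))
    {R Rp : ℕ → Set (ConjClasses G)}
    (hR : ∀ t, 1 ≤ t → R t = reciprocalClass a b ν '' {l | weight l = t})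
    (hRp : ∀ t, Rp t = {γ | γ ∈ R t ∧ ∃ g, IsPrimitiveElement g ∧ ConjClasses.mk g = γ}) :
    Tendsto (fun t : ℕ => ((R t).ncard : ℝ) / ρ ^ t) atTop (𝓝 (c / 2)) ∧
      Tendsto (fun t : ℕ => ((Rp t).ncard : ℝ) / ρ ^ t) atTop (𝓝 (c / 2)) := by
  classical
  have hρ0 : 0 < ρ := by linarith
  have him := h.tendsto_card_imprimitiveWords hfix hρ hc
  have hR' : ∀ t, 1 ≤ t → R t = ((wordsOfWeight E t).image (reciprocalClass a b ν) :) := by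
    intro t ht
    rw [hR t ht, Finset.coe_image]
    congr 1
    ext l
    simp
  have lower : ∀ t, 1 ≤ t → (wordsOfWeight E t).card ≤ 2 * (R t).ncard := by
    intro t ht
    rw [hR' t ht, Set.ncard_coe_finset]
    exact h.card_wordsOfWeight_le t
  have upper : ∀ t, 1 ≤ t →
      2 * (R t).ncard ≤ (wordsOfWeight E t).card + (imprimitiveWords a b ν t).card := by
    intro t ht
    rw [hR' t ht, Set.ncard_coe_finset]
    exact h.two_mul_card_image_le t
  have prim_le : ∀ t, 1 ≤ t → (Rp t).ncard ≤ (R t).ncard := by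
    intro t ht
    refine Set.ncard_le_ncard (fun γ hγ => by rw [hRp] at hγ; exact hγ.1) ?_
    rw [hR' t ht]
    exact Finset.finite_toSet _
  have le_prim : ∀ t, 1 ≤ t → (R t).ncard ≤ (Rp t).ncard + (imprimitiveWords a b ν t).card := by
    intro t ht
    have hfin : (R t).Finite := by
      rw [hR' t ht]
      exact Finset.finite_toSet _
    have hsub : R t ⊆ Rp t ∪ ((imprimitiveWords a b ν t).image (reciprocalClass a b ν) :) := by
      intro γ hγ
      have hγ' := hγ
      rw [hR' t ht, Finset.coe_image] at hγ'
      obtain ⟨l, hl, rfl⟩ := hγ'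
      by_cases hp : IsPrimitiveElement (positiveWord a b (l ++ flipWord ν l))
      · left
        rw [hRp]
        exact ⟨hγ, _, hp, rfl⟩
      · right
        exact Finset.mem_coe.2 (Finset.mem_image_of_mem _ (Finset.mem_filter.2 ⟨hl, hp⟩))
    calc (R t).ncard ≤ _ := Set.ncard_le_ncard hsub
          ((hfin.subset fun γ hγ => by rw [hRp] at hγ; exact hγ.1).union (Finset.finite_toSet _))
      _ ≤ (Rp t).ncard + _ := Set.ncard_union_le _ _
      _ ≤ _ := by
        gcongr
        rw [Set.ncard_coe_finset]
        exact Finset.card_image_le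
  have hRlim : Tendsto (fun t : ℕ => ((R t).ncard : ℝ) / ρ ^ t) atTop (𝓝 (c / 2)) := by
    refine tendsto_of_tendsto_of_tendsto_of_le_of_le' (hc.div_const 2)
      (by simpa using (hc.add him).div_const 2) ?_ ?_
    · filter_upwards [eventually_ge_atTop 1] with t ht
      have : ((wordsOfWeight E t).card : ℝ) ≤ 2 * (R t).ncard := by exact_mod_cast lower t ht
      rw [div_right_comm]
      gcongr
      linarith
    · filter_upwards [eventually_ge_atTop 1] with t ht
      have : 2 * ((R t).ncard : ℝ) ≤
        (wordsOfWeight E t).card + (imprimitiveWords a b ν t).card := by exact_mod_cast upper t ht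
      rw [← add_div, div_right_comm]
      gcongr
      linarith
  refine ⟨hRlim, tendsto_of_tendsto_of_tendsto_of_le_of_le' (by simpa using hRlim.sub him) hRlim
    ?_ ?_⟩
  · filter_upwards [eventually_ge_atTop 1] with t ht
    have : ((R t).ncard : ℝ) ≤ (Rp t).ncard + (imprimitiveWords a b ν t).card := by
      exact_mod_cast le_prim t ht
    rw [← sub_div]
    gcongr
    linarith
  · filter_upwards [eventually_ge_atTop 1] with t ht
    have : ((Rp t).ncard : ℝ) ≤ (R t).ncard := by exact_mod_cast prim_le t ht
    gcongr

/-! ### Commutators in normal form and products of two conjugates of `a` -/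

theorem isBBWord_iff (h : IsFreePair a b E ν) (g : G) :
    IsBBWord a b E g ↔ ∃ l : List E, l ≠ [] ∧ g = a * positiveWord a b l := by
  constructor
  · intro hg
    induction hg with
    | single x hx => exact ⟨[⟨x, hx⟩], by simp, by simp [h.a_mul_a_mul]⟩
    | cons x hx g _ ih =>
      obtain ⟨l, -, rfl⟩ := ih
      exact ⟨⟨x, hx⟩ :: l, by simp, by simp [h.a_mul_a_mul, mul_assoc]⟩
  · rintro ⟨l, hl, rfl⟩
    induction l with
    | nil => exact absurd rfl hl
    | cons x l ih =>
      rcases l with _ | ⟨y, l⟩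
      · simpa [h.a_mul_a_mul] using IsBBWord.single (a := a) (b := b) (x : ℤ) x.2
      · have := IsBBWord.cons (x : ℤ) x.2 _ (ih (by simp))
        simpa [h.a_mul_a_mul, mul_assoc] using this

theorem commutator_eq (h : IsFreePair a b E ν) (l : List E) :
    a * (a * positiveWord a b l) * a⁻¹ * (a * positiveWord a b l)⁻¹ =
      positiveWord a b (l ++ flipWord ν l) := by
  rw [positiveWord_append, ← inv_inv (positiveWord a b (flipWord ν l)), h.inv_positiveWord_flipWord]
  simp only [mul_inv_rev, h.inv_a, mul_assoc, h.a_mul_a_mul]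

theorem ncard_normalForms (h : IsFreePair a b E ν) {t : ℕ} (ht : 1 ≤ t) :
    (normalForms a b E (2 * t)).ncard = (wordsOfWeight E t).card := by
  have hset : normalForms a b E (2 * t) =
      (fun l : List E => positiveWord a b (l ++ flipWord ν l)) '' (wordsOfWeight E t) := by
    ext w
    constructor
    · rintro ⟨⟨g, hg, rfl⟩, hw⟩
      obtain ⟨l, hl, rfl⟩ := (h.isBBWord_iff g).1 hg
      rw [h.commutator_eq] at hw ⊢
      refine ⟨l, ?_, rfl⟩
      rw [h.wordLength_positiveWord (by simp [hl]), weight_append, h.weight_flipWord] at hw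
      rw [Finset.mem_coe, mem_wordsOfWeight]
      omega
    · rintro ⟨l, hl, rfl⟩
      rw [Finset.mem_coe, mem_wordsOfWeight] at hl
      have hne : l ≠ [] := by
        rintro rfl
        simp at hl
        omega
      refine ⟨⟨_, (h.isBBWord_iff _).2 ⟨l, hne, rfl⟩, (h.commutator_eq l).symm⟩, ?_⟩
      rw [h.wordLength_positiveWord (by simp [hne]), weight_append, h.weight_flipWord]
      omega
  rw [hset]
  change ((positiveWord a b ∘ fun l => l ++ flipWord ν l) '' _).ncard = _
  rw [Set.ncard_image_of_injective _
    (h.positiveWord_injective.comp append_flipWord_injective), Set.ncard_coe_finset]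

/-- Up to conjugation, a product of two distinct conjugates of `a` is the commutator of `a` and a
reduced word. -/
theorem exists_isConj_mul_of_isConj (h : IsFreePair a b E ν) {u v : G} (huv : u ≠ v)
    (hu : IsConj a u) (hv : IsConj a v) :
    ∃ l : List E, l ≠ [] ∧ IsConj (positiveWord a b (l ++ flipWord ν l)) (u * v) := by
  obtain ⟨c, rfl⟩ := isConj_iff.1 hu
  obtain ⟨d, rfl⟩ := isConj_iff.1 hv
  obtain ⟨l, hl⟩ := h.exists_positiveWord_eq (c⁻¹ * d)
  have h1 : IsConj (a * (c⁻¹ * d) * a * (c⁻¹ * d)⁻¹) (c * a * c⁻¹ * (d * a * d⁻¹)) :=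
    isConj_iff.2 ⟨c, by group⟩
  have hconj : IsConj (positiveWord a b (l ++ flipWord ν l)) (a * (c⁻¹ * d) * a * (c⁻¹ * d)⁻¹) := by
    rw [← h.commutator_eq]
    rcases hl with hl | hl | hl | hl <;> rw [hl]
    · exact isConj_iff.2 ⟨a, by
        simp only [mul_inv_rev, h.inv_a, mul_assoc, h.a_mul_a_mul, h.a_mul_a, mul_one]⟩
    · rw [h.inv_a]
    · exact isConj_iff.2 ⟨a, by
        simp only [mul_inv_rev, h.inv_a, mul_assoc, h.a_mul_a_mul, h.a_mul_a, mul_one]⟩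
    · simp only [mul_inv_rev, h.inv_a, mul_assoc, h.a_mul_a_mul]
      exact IsConj.refl _
  refine ⟨l, ?_, hconj.trans h1⟩
  rintro rfl
  have h2 := hconj.trans h1
  simp only [flipWord_nil, List.append_nil, positiveWord_nil, isConj_one_right] at h2
  exact huv ((eq_inv_of_mul_eq_one_left h2).trans (by simp [h.inv_a, mul_assoc]))

end IsFreePair

/-! ### Matrices with nonnegative entries -/

theorem psl_mk_eq_mk_iff (M N : SL(2, ℝ)) :
    (QuotientGroup.mk M : PSL(2, ℝ)) = QuotientGroup.mk N ↔ N = M ∨ N = -M := by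
  rw [QuotientGroup.eq, Matrix.SpecialLinearGroup.mem_center_iff]
  constructor
  · rintro ⟨r, hr, h⟩
    have h1 : (N : Matrix (Fin 2) (Fin 2) ℝ) = r • (M : Matrix (Fin 2) (Fin 2) ℝ) := by
      have h2 : M * (M⁻¹ * N) = N := by group
      rw [← h2, Matrix.SpecialLinearGroup.coe_mul, ← h, Matrix.scalar_apply,
        ← Matrix.smul_one_eq_diagonal]
      simp
    rw [Fintype.card_fin, pow_two, mul_self_eq_one_iff] at hr
    rcases hr with rfl | rfl
    · left; ext i j; simp [h1]
    · right; ext i j; simp [h1]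
  · rintro (rfl | rfl)
    · exact ⟨1, by simp, by simp⟩
    · refine ⟨-1, by simp, ?_⟩
      rw [mul_neg, inv_mul_cancel, Matrix.SpecialLinearGroup.coe_neg, map_neg, map_one]
      rfl

/-- An element of `PSL(2, ℝ)` is nonnegative if it has a lift with nonnegative entries whose
diagonal entries are at least `1`. -/
def IsNonneg (g : PSL(2, ℝ)) : Prop :=
  ∃ M : SL(2, ℝ), QuotientGroup.mk M = g ∧ 1 ≤ M 0 0 ∧ 1 ≤ M 1 1 ∧ 0 ≤ M 0 1 ∧ 0 ≤ M 1 0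

/-- A nonnegative element whose lift has a nonzero entry off the diagonal. -/
def IsPos (g : PSL(2, ℝ)) : Prop :=
  ∃ M : SL(2, ℝ), QuotientGroup.mk M = g ∧ 1 ≤ M 0 0 ∧ 1 ≤ M 1 1 ∧ 0 ≤ M 0 1 ∧ 0 ≤ M 1 0 ∧
    0 < M 0 1 + M 1 0

theorem IsPos.isNonneg {g : PSL(2, ℝ)} (hg : IsPos g) : IsNonneg g := by
  obtain ⟨M, h⟩ := hg
  exact ⟨M, by tauto⟩

theorem isNonneg_one : IsNonneg 1 := ⟨1, rfl, by simp⟩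

theorem IsPos.mul {g g' : PSL(2, ℝ)} (hg : IsPos g) (hg' : IsNonneg g') : IsPos (g * g') := by
  obtain ⟨M, rfl, h1, h2, h3, h4, h5⟩ := hg
  obtain ⟨N, rfl, k1, k2, k3, k4⟩ := hg'
  refine ⟨M * N, rfl, ?_⟩
  simp only [Matrix.SpecialLinearGroup.coe_mul, Matrix.mul_apply, Fin.sum_univ_two]
  have e1 : 0 ≤ M 0 1 * N 1 0 := mul_nonneg h3 k4
  have e2 : 0 ≤ M 1 0 * N 0 1 := mul_nonneg h4 k3
  have e3 : 0 ≤ M 0 0 * N 0 1 := mul_nonneg (by linarith) k3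
  have e4 : 0 ≤ M 1 1 * N 1 0 := mul_nonneg (by linarith) k4
  have e5 : M 0 1 ≤ M 0 1 * N 1 1 := le_mul_of_one_le_right h3 k2
  have e6 : M 1 0 ≤ M 1 0 * N 0 0 := le_mul_of_one_le_right h4 k1
  have e7 : 1 ≤ M 0 0 * N 0 0 := one_le_mul_of_one_le_of_one_le h1 k1
  have e8 : 1 ≤ M 1 1 * N 1 1 := one_le_mul_of_one_le_of_one_le h2 k2
  refine ⟨?_, ?_, ?_, ?_, ?_⟩ <;> linarith

theorem IsPos.ne_one {g : PSL(2, ℝ)} (hg : IsPos g) : g ≠ 1 := by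
  obtain ⟨M, rfl, h1, h2, h3, h4, h5⟩ := hg
  intro h
  have : (QuotientGroup.mk 1 : PSL(2, ℝ)) = QuotientGroup.mk M := h.symm
  rcases (psl_mk_eq_mk_iff 1 M).1 this with rfl | rfl
  · simp at h5
  · simp at h5

theorem slMatrix_zero_mul (M : Matrix (Fin 2) (Fin 2) ℝ) :
    (slMatrix 0 : Matrix (Fin 2) (Fin 2) ℝ) * M = !![-M 1 0, -M 1 1; M 0 0, M 0 1] := by
  ext i j
  fin_cases i <;> fin_cases j <;> simp [slMatrix, Matrix.mul_apply, Fin.sum_univ_two]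

/-- Multiplication by `A` exchanges the rows up to a sign, which gives a sign change. -/
theorem IsNonneg.not_isNonneg_matA_mul {g : PSL(2, ℝ)} (hg : IsNonneg g) :
    ¬ IsNonneg (matA * g) := by
  obtain ⟨M, rfl, h1, h2, h3, h4⟩ := hg
  rintro ⟨N, hN, k1, k2, k3, k4⟩
  change (QuotientGroup.mk N : PSL(2, ℝ)) = QuotientGroup.mk (slMatrix 0 * M) at hN
  rw [eq_comm, psl_mk_eq_mk_iff] at hN
  rcases hN with rfl | rfl
  · simp [slMatrix_zero_mul] at k1 k2 k3 k4
    linarith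
  · simp [slMatrix_zero_mul] at k1 k2 k3 k4
    linarith

/-! ### Powers of the second generator -/

/-- A sequence of Chebyshev type with parameter `x`, such as `j ↦ sin (j θ) / sin θ` for
`x = 2 cos θ` and `j ↦ j` for `x = 2`. -/
structure IsChebyshev (x : ℝ) (s : ℤ → ℝ) : Prop where
  zero : s 0 = 0
  one : s 1 = 1
  recurrence : ∀ j, s (j + 1) + s (j - 1) = x * s j

namespace IsChebyshev

variable {x : ℝ} {s : ℤ → ℝ} 
theorem zpow_slMatrix (hs : IsChebyshev x s) (j : ℤ) :
    ((slMatrix x ^ j : SL(2, ℝ)) : Matrix (Fin 2) (Fin 2) ℝ) =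
      !![-s (j - 1), -s j; s j, s (j + 1)] := by
  induction j using Int.induction_on with
  | zero =>
    have h0 := hs.recurrence 0
    simp only [hs.zero, hs.one, zero_add, mul_zero] at h0
    ext i j
    fin_cases i <;> fin_cases j <;> simp [hs.zero, hs.one]
    simp at h0
    linarith
  | succ n ih =>
    have h1 := hs.recurrence n
    have h2 := hs.recurrence (n + 1)
    rw [add_sub_cancel_right] at h2
    rw [zpow_add_one, Matrix.SpecialLinearGroup.coe_mul, ih]
    ext i k
    fin_cases i <;> fin_cases k <;> simp [slMatrix, Matrix.mul_apply, Fin.sum_univ_two] <;> linarith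
  | pred n ih =>
    have h1 := hs.recurrence (-n)
    have h2 := hs.recurrence (-n - 1)
    rw [sub_add_cancel] at h2
    rw [zpow_sub_one, Matrix.SpecialLinearGroup.coe_mul, ih, Matrix.SpecialLinearGroup.coe_inv]
    ext i k
    fin_cases i <;> fin_cases k <;>
      simp [slMatrix, Matrix.mul_apply, Fin.sum_univ_two, Matrix.adjugate_fin_two] <;> linarith

/-- `A B ^ j` is positive if the sequence has constant sign around `j`. -/
theorem isPos (hs : IsChebyshev x s) {j : ℤ}
    (hj : (1 ≤ s j ∧ 0 ≤ s (j + 1) ∧ 0 ≤ s (j - 1) ∧ 0 < s (j + 1) + s (j - 1)) ∨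
      (s j ≤ -1 ∧ s (j + 1) ≤ 0 ∧ s (j - 1) ≤ 0 ∧ s (j + 1) + s (j - 1) < 0)) :
    IsPos (matA * (QuotientGroup.mk (slMatrix x) : PSL(2, ℝ)) ^ j) := by
  change IsPos (QuotientGroup.mk (slMatrix 0 * slMatrix x ^ j))
  rcases hj with ⟨h1, h2, h3, h4⟩ | ⟨h1, h2, h3, h4⟩
  · refine ⟨-(slMatrix 0 * slMatrix x ^ j), (psl_mk_eq_mk_iff _ _).2 (.inr (neg_neg _).symm), ?_⟩
    simp [slMatrix_zero_mul, hs.zpow_slMatrix]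
    refine ⟨?_, ?_, ?_, ?_⟩ <;> linarith
  · refine ⟨slMatrix 0 * slMatrix x ^ j, rfl, ?_⟩
    simp [slMatrix_zero_mul, hs.zpow_slMatrix]
    refine ⟨?_, ?_, ?_, ?_⟩ <;> linarith

end IsChebyshev

theorem isChebyshev_intCast : IsChebyshev 2 (fun j => (j : ℝ)) where
  zero := by simp
  one := by simp
  recurrence j := by push_cast; ring

theorem isChebyshev_sin {θ : ℝ} (hθ : Real.sin θ ≠ 0) :
    IsChebyshev (2 * Real.cos θ) (fun j => Real.sin (j * θ) / Real.sin θ) where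
  zero := by simp
  one := by simp [hθ]
  recurrence j := by
    push_cast
    rw [add_mul, sub_mul, one_mul, Real.sin_add, Real.sin_sub]
    field_simp
    ring

/-! ### The Hecke groups as free products -/

/-- The inversion of exponents: `x ↦ -x`, except that `κ / 2` is fixed for even `κ`. The value
`κ = 0` stands for infinite order. -/
def inversion (κ x : ℤ) : ℤ := if 2 * x = κ then x else -x

/-- The exponents of reduced words for `b` of order `κ`, with `κ = 0` for infinite order. -/
def reducedExponents (κ : ℕ) : Set ℤ := if κ = 0 then {x | x ≠ 0} else exponentSet κ

theorem mem_reducedExponents_iff {κ : ℕ} {x : ℤ} : x ∈ reducedExponents κ ↔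
    x ≠ 0 ∧ (κ = 0 ∨ -(((κ : ℤ) - 1) / 2) ≤ x ∧ x ≤ (κ : ℤ) / 2) := by
  unfold reducedExponents exponentSet
  split_ifs with h <;> simp [h]

theorem inversion_mem {κ : ℕ} {x : ℤ} (hx : x ∈ reducedExponents κ) :
    inversion κ x ∈ reducedExponents κ := by
  rw [mem_reducedExponents_iff] at *
  unfold inversion
  split_ifs <;> omega

/-- The inversion of exponents as a map of the letters. -/
def letterInversion (κ : ℕ) (x : reducedExponents κ) : reducedExponents κ :=
  ⟨inversion κ x, inversion_mem x.2⟩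

theorem not_dvd_of_mem_reducedExponents {κ : ℕ} {x : ℤ} (hx : x ∈ reducedExponents κ) :
    ¬ (κ : ℤ) ∣ x := by
  rw [mem_reducedExponents_iff] at hx
  intro h
  rcases hx with ⟨h0, h1 | h1⟩
  · subst h1
    simp at h
    exact h0 h
  · have := Int.le_of_dvd (b := |x|) (abs_pos.2 h0) ((dvd_abs _ _).2 h)
    rcases abs_cases x with ⟨h2, -⟩ | ⟨h2, -⟩ <;> omega

theorem eq_of_dvd_sub_of_mem {κ : ℕ} {x y : ℤ} (hx : x ∈ reducedExponents κ)
    (hy : y ∈ reducedExponents κ) (h : (κ : ℤ) ∣ y - x) : x = y := by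
  rw [mem_reducedExponents_iff] at hx hy
  by_contra hne
  rcases Nat.eq_zero_or_pos κ with h0 | h0
  · subst h0
    simp at h
    omega
  · have := Int.le_of_dvd (b := |y - x|) (abs_pos.2 (by omega)) ((dvd_abs _ _).2 h)
    rcases abs_cases (y - x) with ⟨h2, -⟩ | ⟨h2, -⟩ <;> omega

theorem exists_mem_reducedExponents {κ : ℕ} {z : ℤ} (hz : ¬ (κ : ℤ) ∣ z) :
    ∃ x ∈ reducedExponents κ, (κ : ℤ) ∣ z - x ∧ x.natAbs ≤ z.natAbs := by
  rcases Nat.eq_zero_or_pos κ with h0 | h0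
  · subst h0
    exact ⟨z, by simpa [mem_reducedExponents_iff] using hz, by simp⟩
  have h1 := Int.emod_nonneg z (b := κ) (by omega)
  have h2 := Int.emod_lt_of_pos z (b := κ) (by omega)
  have h3 : z % κ ≠ 0 := fun h => hz (Int.dvd_of_emod_eq_zero h)
  have h4 := Int.dvd_sub_self_of_emod_eq (a := z) (b := κ) rfl
  have h4 : (κ : ℤ) ∣ z - z % κ := by simpa using (dvd_neg.2 h4)
  obtain ⟨q, hq⟩ := h4
  by_cases hlt : 2 * (z % κ) ≤ κ
  · refine ⟨z % κ, mem_reducedExponents_iff.2 ⟨h3, .inr (by omega)⟩, ⟨q, hq⟩, ?_⟩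
    rcases lt_trichotomy q 0 with h5 | h5 | h5
    · have : (κ : ℤ) * q ≤ -κ := by nlinarith
      omega
    · subst h5; omega
    · have : 0 ≤ (κ : ℤ) * q := by positivity
      omega
  · refine ⟨z % κ - κ, mem_reducedExponents_iff.2 ⟨by omega, .inr (by omega)⟩,
      ⟨q + 1, by rw [mul_add, ← hq]; ring⟩, ?_⟩
    rcases lt_trichotomy q 0 with h5 | h5 | h5
    · have : (κ : ℤ) * q ≤ -κ := by nlinarith
      omega
    · subst h5; omega
    · have : 0 ≤ (κ : ℤ) * q := by positivity
      omega

section HeckePair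

variable {k : ℕ∞} {κ : ℕ}

/-- `B` has order `κ`, and the nontrivial elements `A B ^ z` are positive. -/
structure HasPositivePowers (k : ℕ∞) (κ : ℕ) : Prop where
  zpow_eq_one : ∀ z : ℤ, (κ : ℤ) ∣ z → matB k ^ z = 1
  isPos : ∀ z : ℤ, ¬ (κ : ℤ) ∣ z → IsPos (matA * matB k ^ z)

theorem matA_mul_matA : matA * matA = 1 := by
  change (QuotientGroup.mk (slMatrix 0 * slMatrix 0) : PSL(2, ℝ)) = QuotientGroup.mk 1
  rw [psl_mk_eq_mk_iff]
  right
  ext i j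
  fin_cases i <;> fin_cases j <;> simp [slMatrix_zero_mul] <;> simp [slMatrix]

namespace HasPositivePowers

theorem genB_zpow_eq (h : HasPositivePowers k κ) {z y : ℤ} (hd : (κ : ℤ) ∣ z - y) :
    genB k ^ z = genB k ^ y := by
  have h1 : genB k ^ (z - y) = 1 := Subtype.ext (by simpa using! h.zpow_eq_one _ hd)
  rwa [zpow_sub, mul_inv_eq_one] at h1

theorem isNonneg_positiveWord (h : HasPositivePowers k κ) (l : List (reducedExponents κ)) :
    IsNonneg ((positiveWord (genA k) (genB k) l : heckeGroup k) : PSL(2, ℝ)) := by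
  induction l with
  | nil => exact isNonneg_one
  | cons x l ih =>
    have := ((h.isPos x (not_dvd_of_mem_reducedExponents x.2)).mul ih).isNonneg
    simpa using! this

theorem isPos_mul_positiveWord (h : HasPositivePowers k κ) {z : ℤ} (hz : ¬ (κ : ℤ) ∣ z)
    (l : List (reducedExponents κ)) :
    IsPos ((genA k * genB k ^ z * positiveWord (genA k) (genB k) l : heckeGroup k) :
      PSL(2, ℝ)) :=
  (h.isPos z hz).mul (h.isNonneg_positiveWord l)

/-- Positive words are distinct: after cancelling a common beginning, a coincidence of two of them
would make an element nonnegative together with its product by `A`. -/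
theorem positiveWord_injective (h : HasPositivePowers k κ) :
    Function.Injective (positiveWord (genA k) (genB k) : List (reducedExponents κ) → _) := by
  intro l
  induction l with
  | nil =>
    rintro (_ | ⟨y, l'⟩) hl
    · rfl
    · have := (h.isPos_mul_positiveWord (not_dvd_of_mem_reducedExponents y.2) l').ne_one
      rw [← positiveWord_cons, ← hl] at this
      exact absurd rfl this
  | cons x l ih =>
    rintro (_ | ⟨y, l'⟩) hl
    · have := (h.isPos_mul_positiveWord (not_dvd_of_mem_reducedExponents x.2) l).ne_one
      rw [← positiveWord_cons, hl] at this
      exact absurd rfl this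
    · by_cases hxy : x = y
      · subst hxy
        rw [ih (by simpa using hl)]
      · exfalso
        have h1 : ¬ (κ : ℤ) ∣ (y : ℤ) - x := fun hd =>
          hxy (Subtype.ext (eq_of_dvd_sub_of_mem x.2 y.2 hd))
        have h2 := (h.isPos_mul_positiveWord h1 l').isNonneg
        simp only [positiveWord_cons, mul_assoc, mul_right_inj] at hl
        have h3 : genA k * genB k ^ ((y : ℤ) - x) * positiveWord (genA k) (genB k) l' =
            genA k * positiveWord (genA k) (genB k) l := by
          rw [mul_assoc, mul_right_inj, sub_eq_neg_add, zpow_add, mul_assoc, ← hl, zpow_neg,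
            inv_mul_cancel_left]
        rw [h3] at h2
        exact (h.isNonneg_positiveWord l).not_isNonneg_matA_mul h2

theorem isFreePair (h : HasPositivePowers k κ) :
    IsFreePair (genA k) (genB k) (reducedExponents κ) (letterInversion κ) where
  a_mul_a := Subtype.ext matA_mul_matA
  closure_eq_top := by
    convert! Subgroup.closure_closure_coe_preimage (k := {matA, matB k}) using 2
    ext x
    simp only [genA, genB, Subtype.ext_iff, Set.mem_insert_iff, Set.mem_singleton_iff]
    exact Iff.rfl
  zpow_eq z := by
    by_cases hz : (κ : ℤ) ∣ z
    · left
      simpa using h.genB_zpow_eq (z := z) (y := 0) (by simpa using hz)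
    · right
      obtain ⟨x, hx, hd, hle⟩ := exists_mem_reducedExponents hz
      exact ⟨⟨x, hx⟩, h.genB_zpow_eq hd, hle⟩
  zpow_inversion x := by
    rw [← zpow_neg]
    apply h.genB_zpow_eq
    simp only [letterInversion, inversion]
    split_ifs with h1
    · rw [← h1]; simp; ring_nf; simp
    · simp
  natAbs_inversion x := by
    simp only [letterInversion, inversion]
    split_ifs <;> simp
  inversion_inversion x := by
    apply Subtype.ext
    have := mem_reducedExponents_iff.1 x.2
    simp only [letterInversion, inversion]
    split_ifs <;> omega
  positiveWord_injective := h.positiveWord_injective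
  mul_positiveWord_ne l l' heq :=
    (h.isNonneg_positiveWord l).not_isNonneg_matA_mul (by
      have := h.isNonneg_positiveWord l'
      rw [← heq] at this
      exact this)

end HasPositivePowers

theorem finite_setOf_letterInversion_eq (κ : ℕ) : {x | letterInversion κ x = x}.Finite := by
  apply Set.Subsingleton.finite
  intro x hx y hy
  have hx' := congrArg Subtype.val hx
  have hy' := congrArg Subtype.val hy
  have h1 := (mem_reducedExponents_iff.1 x.2).1
  have h2 := (mem_reducedExponents_iff.1 y.2).1
  simp only [letterInversion, inversion] at hx' hy'
  apply Subtype.ext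
  split_ifs at hx' hy' <;> omega

theorem hasPositivePowers_top : HasPositivePowers ⊤ 0 where
  zpow_eq_one z hz := by
    obtain rfl : z = 0 := by simpa using hz
    simp
  isPos z hz := by
    have hz : z ≠ 0 := by simpa using hz
    apply isChebyshev_intCast.isPos
    rcases lt_or_gt_of_ne hz with h | h
    · right
      have h' : (z : ℝ) ≤ -1 := by exact_mod_cast (by omega : z ≤ -1)
      push_cast
      refine ⟨h', ?_, ?_, ?_⟩ <;> linarith
    · left
      have h' : (1 : ℝ) ≤ z := by exact_mod_cast h
      push_cast
      refine ⟨h', ?_, ?_, ?_⟩ <;> linarith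

theorem hasPositivePowers_natCast {κ : ℕ} (hκ : 3 ≤ κ) : HasPositivePowers (κ : ℕ∞) κ := by
  have hκ' : (3 : ℝ) ≤ κ := by exact_mod_cast hκ
  set θ := Real.pi / κ with hθ
  have hκθ : κ * θ = Real.pi := by rw [hθ]; field_simp
  have hθ0 : 0 < θ := by positivity
  have hθ2 : 2 * θ < Real.pi := by rw [← hκθ]; nlinarith
  have hsin : 0 < Real.sin θ := Real.sin_pos_of_pos_of_lt_pi hθ0 (by linarith)
  have hcos : 0 < Real.cos θ := Real.cos_pos_of_mem_Ioo ⟨by linarith, by linarith⟩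
  have hs := isChebyshev_sin hsin.ne'
  have hB : matB (κ : ℕ∞) = QuotientGroup.mk (slMatrix (2 * Real.cos θ)) := rfl
  have hone : matB (κ : ℕ∞) ^ (κ : ℤ) = 1 := by
    rw [hB]
    change (QuotientGroup.mk (slMatrix (2 * Real.cos θ) ^ (κ : ℤ)) : PSL(2, ℝ)) = QuotientGroup.mk 1
    rw [psl_mk_eq_mk_iff]
    right
    ext i j
    have h1 := hs.zpow_slMatrix κ
    simp only [Int.cast_natCast, Int.cast_sub, Int.cast_add, Int.cast_one, sub_mul, add_mul, hκθ,
      one_mul, Real.sin_pi, Real.sin_pi_sub, zero_div, neg_zero, add_comm Real.pi,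
      Real.sin_add_pi, neg_div, div_self hsin.ne'] at h1
    rw [Matrix.SpecialLinearGroup.coe_neg, h1]
    fin_cases i <;> fin_cases j <;> simp
  have hone' : ∀ z : ℤ, (κ : ℤ) ∣ z → matB (κ : ℕ∞) ^ z = 1 := by
    rintro z ⟨q, rfl⟩
    rw [zpow_mul, hone, one_zpow]
  refine ⟨hone', fun z hz => ?_⟩
  have hmod : matB (κ : ℕ∞) ^ z = matB (κ : ℕ∞) ^ (z % κ) := by
    conv_lhs => rw [← Int.emod_add_mul_ediv z κ, zpow_add, zpow_mul, hone, one_zpow, mul_one]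
  have h1 := Int.emod_nonneg z (b := κ) (by omega)
  have h2 := Int.emod_lt_of_pos z (b := κ) (by omega)
  have h3 : z % κ ≠ 0 := fun h => hz (Int.dvd_of_emod_eq_zero h)
  rw [hmod, hB]
  generalize z % κ = j at h1 h2 h3
  have hj1 : (1 : ℝ) ≤ j := by exact_mod_cast (by omega : 1 ≤ j)
  have hj2 : (j : ℝ) + 1 ≤ κ := by exact_mod_cast (by omega : j + 1 ≤ (κ : ℤ))
  have hjθ : θ ≤ j * θ := by nlinarith
  have hjθ' : j * θ + θ ≤ Real.pi := by rw [← hκθ]; nlinarith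
  have hge : Real.sin θ ≤ Real.sin (j * θ) := by
    rw [← sub_nonneg, Real.sin_sub_sin]
    have e1 : 0 ≤ Real.sin ((j * θ - θ) / 2) :=
      Real.sin_nonneg_of_nonneg_of_le_pi (by linarith) (by linarith)
    have e2 : 0 ≤ Real.cos ((j * θ + θ) / 2) :=
      Real.cos_nonneg_of_mem_Icc ⟨by linarith, by linarith⟩
    positivity
  have hup : 0 ≤ Real.sin ((j + 1) * θ) :=
    Real.sin_nonneg_of_nonneg_of_le_pi (by nlinarith) (by linarith)
  have hdown : 0 ≤ Real.sin ((j - 1) * θ) :=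
    Real.sin_nonneg_of_nonneg_of_le_pi (by nlinarith) (by linarith)
  apply hs.isPos
  left
  have hrec := hs.recurrence j
  refine ⟨?_, ?_, ?_, ?_⟩
  · rwa [one_le_div hsin]
  · push_cast; positivity
  · push_cast; positivity
  · rw [hrec]
    have : 0 < Real.sin (j * θ) := by linarith
    positivity

end HeckePair

/-! ### Involutions over the cone point and hyperbolic elements -/

section Geometry

variable {k : ℕ∞}

/-- The elements of `SL(2, ℝ)` fixing `i` are the rotations. -/
theorem eq_and_eq_of_smul_I (M : SL(2, ℝ)) (hM : M • UpperHalfPlane.I = UpperHalfPlane.I) :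
    M 0 0 = M 1 1 ∧ M 0 1 = -M 1 0 := by
  have h1 := congrArg (fun z : ℍ => (z : ℂ)) hM
  simp only [UpperHalfPlane.coe_specialLinearGroup_apply] at h1
  have h2 : ((M 1 0 : ℝ) * Complex.I + (M 1 1 : ℝ) : ℂ) ≠ 0 := by
    intro h
    have := UpperHalfPlane.denom_ne_zero M UpperHalfPlane.I
    exact this (by simpa [UpperHalfPlane.denom] using h)
  rw [UpperHalfPlane.coe_I] at h1
  simp only [Algebra.algebraMap_self, RingHom.id_apply] at h1
  rw [div_eq_iff h2] at h1
  have h3 := congrArg Complex.re h1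
  have h4 := congrArg Complex.im h1
  simp at h3 h4
  exact ⟨h4, h3⟩

theorem matA_smul_I : (matA : PSL(2, ℝ)) • UpperHalfPlane.I = UpperHalfPlane.I := by
  change slMatrix 0 • UpperHalfPlane.I = UpperHalfPlane.I
  ext
  rw [UpperHalfPlane.coe_specialLinearGroup_apply]
  simp [slMatrix]

/-- The only involution fixing `i` is `A`. -/
theorem eq_matA_of_smul_I {g : PSL(2, ℝ)} (hg : g • UpperHalfPlane.I = UpperHalfPlane.I)
    (h1 : g ≠ 1) (h2 : g * g = 1) : g = matA := by
  obtain ⟨M, rfl⟩ := QuotientGroup.mk_surjective g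
  obtain ⟨e1, e2⟩ := eq_and_eq_of_smul_I M hg
  have hdet := M.det_coe
  rw [Matrix.det_fin_two] at hdet
  have h3 : M 0 0 * M 1 0 = 0 := by
    change (QuotientGroup.mk (M * M) : PSL(2, ℝ)) = QuotientGroup.mk 1 at h2
    have h4 : (M * M) 1 0 = 0 := by
      rcases (psl_mk_eq_mk_iff _ _).1 h2.symm with h | h <;> rw [h] <;> simp
    rw [Matrix.SpecialLinearGroup.coe_mul, Matrix.mul_apply, Fin.sum_univ_two] at h4
    rw [← e1] at h4
    linarith
  change QuotientGroup.mk M = (QuotientGroup.mk (slMatrix 0) : PSL(2, ℝ))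
  rcases mul_eq_zero.1 h3 with h | h
  · rw [e2, ← e1, h] at hdet
    have h5 : M 1 0 * M 1 0 = 1 := by linarith
    rw [psl_mk_eq_mk_iff]
    rcases mul_self_eq_one_iff.1 h5 with h6 | h6
    · left
      ext i j
      fin_cases i <;> fin_cases j <;> simp [slMatrix, h, ← e1, e2, h6]
    · right
      ext i j
      fin_cases i <;> fin_cases j <;> simp [slMatrix, h, ← e1, e2, h6]
  · exfalso
    apply h1
    rw [e2, ← e1, h] at hdet
    have h5 : M 0 0 * M 0 0 = 1 := by linarith
    change QuotientGroup.mk M = (QuotientGroup.mk 1 : PSL(2, ℝ))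
    rw [eq_comm, psl_mk_eq_mk_iff]
    rcases mul_self_eq_one_iff.1 h5 with h6 | h6
    · left
      ext i j
      fin_cases i <;> fin_cases j <;> simp [h, ← e1, e2, h6]
    · right
      ext i j
      fin_cases i <;> fin_cases j <;> simp [h, ← e1, e2, h6]

theorem genA_mul_genA : genA k * genA k = 1 := Subtype.ext matA_mul_matA

theorem orderOf_genA : orderOf (genA k) = 2 := by
  apply orderOf_eq_prime
  · rw [pow_two, genA_mul_genA]
  · intro h
    have h1 : matA = 1 := congrArg Subtype.val h
    have h2 := isNonneg_one.not_isNonneg_matA_mul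
    rw [h1, mul_one] at h2
    exact h2 isNonneg_one

/-- The involutions over the cone point of order two are the conjugates of `A`. -/
theorem isInvolutionOver_iff (u : heckeGroup k) :
    IsInvolutionOver (conePointTwo k) u ↔ IsConj (genA k) u := by
  constructor
  · rintro ⟨hu, z, hz, hp⟩
    have hz' : z ∈ MulAction.orbit (heckeGroup k) UpperHalfPlane.I :=
      MulAction.orbitRel_apply.1 (Quotient.exact hp)
    obtain ⟨g, rfl⟩ := hz'
    have h1 : (g⁻¹ * u * g) • UpperHalfPlane.I = UpperHalfPlane.I := by
      rw [mul_smul, mul_smul, hz, inv_smul_smul]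
    have h2 : u * u = 1 := by
      have := pow_orderOf_eq_one u
      rwa [hu, pow_two] at this
    have h3 : u ≠ 1 := by rintro rfl; simp at hu
    have h4 : ((g⁻¹ * u * g : heckeGroup k) : PSL(2, ℝ)) = matA := by
      apply eq_matA_of_smul_I h1
      · intro h
        apply h3
        have h5 : g⁻¹ * u * g = 1 := Subtype.ext h
        calc u = g * (g⁻¹ * u * g) * g⁻¹ := by group
          _ = 1 := by rw [h5]; group
      · have h5 : (g⁻¹ * u * g) * (g⁻¹ * u * g) = 1 := by
          calc (g⁻¹ * u * g) * (g⁻¹ * u * g) = g⁻¹ * (u * u) * g := by group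
            _ = 1 := by rw [h2]; group
        exact congrArg Subtype.val h5
    have h5 : g⁻¹ * u * g = genA k := Subtype.ext h4
    exact isConj_iff.2 ⟨g, by rw [← h5]; group⟩
  · intro h
    obtain ⟨g, rfl⟩ := isConj_iff.1 h
    refine ⟨?_, g • UpperHalfPlane.I, ?_, ?_⟩
    · refine Eq.trans ?_ (orderOf_genA (k := k))
      have := orderOf_injective (MulAut.conj g).toMonoidHom (MulAut.conj g).injective (genA k)
      simpa using this
    · rw [mul_smul, mul_smul, inv_smul_smul]
      congr 1
      exact matA_smul_I
    · exact Quotient.sound (MulAction.orbitRel_apply.2 ⟨g, rfl⟩)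

/-- The commutator of `A` with a matrix has trace the sum of the squares of the entries, which is
larger than `2` unless the matrix is a rotation. -/
theorem isHyperbolicElement_commutator {g : heckeGroup k}
    (hg : genA k * g * (genA k)⁻¹ * g⁻¹ ≠ 1) :
    IsHyperbolicElement (genA k * g * (genA k)⁻¹ * g⁻¹) := by
  obtain ⟨M, hM⟩ := QuotientGroup.mk_surjective (g : PSL(2, ℝ))
  have hmk : (QuotientGroup.mk (slMatrix 0 * M * (slMatrix 0)⁻¹ * M⁻¹) : PSL(2, ℝ)) =
      (genA k * g * (genA k)⁻¹ * g⁻¹ : heckeGroup k) := by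
    change matA * QuotientGroup.mk M * matA⁻¹ * (QuotientGroup.mk M)⁻¹ = _
    rw [hM]
    rfl
  refine ⟨_, hmk, ?_⟩
  have hdet := M.det_coe
  rw [Matrix.det_fin_two] at hdet
  have htr : ((slMatrix 0 * M * (slMatrix 0)⁻¹ * M⁻¹ : SL(2, ℝ)) : Matrix (Fin 2) (Fin 2) ℝ).trace =
      M 0 0 ^ 2 + M 0 1 ^ 2 + M 1 0 ^ 2 + M 1 1 ^ 2 := by
    simp only [Matrix.SpecialLinearGroup.coe_mul, slMatrix_zero_mul,
      Matrix.SpecialLinearGroup.coe_inv, Matrix.adjugate_fin_two, Matrix.trace_fin_two]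
    simp [slMatrix, Matrix.mul_apply, Fin.sum_univ_two]
    ring
  have hne : (M 0 0 - M 1 1) ^ 2 + (M 0 1 + M 1 0) ^ 2 ≠ 0 := by
    intro h
    have e1 : M 0 0 - M 1 1 = 0 := by
      nlinarith [sq_nonneg (M 0 0 - M 1 1), sq_nonneg (M 0 1 + M 1 0)]
    have e2 : M 0 1 + M 1 0 = 0 := by
      nlinarith [sq_nonneg (M 0 0 - M 1 1), sq_nonneg (M 0 1 + M 1 0)]
    apply hg
    have hcomm : slMatrix 0 * M = M * slMatrix 0 := by
      ext i j
      rw [Matrix.SpecialLinearGroup.coe_mul, Matrix.SpecialLinearGroup.coe_mul, slMatrix_zero_mul]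
      fin_cases i <;> fin_cases j <;>
        simp [slMatrix, Matrix.mul_apply, Fin.sum_univ_two] <;> linarith
    apply Subtype.ext
    rw [← hmk, hcomm, mul_inv_cancel_right, mul_inv_cancel]
    rfl
  rw [Matrix.IsHyperbolic, Matrix.discr_fin_two, htr, Matrix.SpecialLinearGroup.det_coe]
  have hpos : 0 < (M 0 0 - M 1 1) ^ 2 + (M 0 1 + M 1 0) ^ 2 :=
    lt_of_le_of_ne (by positivity) hne.symm
  nlinarith

end Geometry

/-- The reciprocal geodesics of length `2t` are the classes attached to the words of weight `t`. -/
theorem reciprocalGeodesics_eq {k : ℕ∞} {κ : ℕ} (h : HasPositivePowers k κ) {t : ℕ} (ht : 1 ≤ t) :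
    reciprocalGeodesics k (conePointTwo k) (2 * t) =
      reciprocalClass (genA k) (genB k) (letterInversion κ) '' {l | weight l = t} := by
  have hF := h.isFreePair
  ext γ
  constructor
  · rintro ⟨⟨g, ⟨-, u, v, huv, -, hu, hv, rfl⟩, rfl⟩, hlen⟩
    rw [isInvolutionOver_iff] at hu hv
    obtain ⟨l, hl, hc⟩ := hF.exists_isConj_mul_of_isConj huv hu hv
    rw [← ConjClasses.mk_eq_mk_iff_isConj] at hc
    refine ⟨l, ?_, hc⟩
    rw [← hc, hF.classLength_positiveWord (by simp [hl]), weight_append, hF.weight_flipWord] at hlen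
    simp only [Set.mem_ofPred_eq]
    omega
  · rintro ⟨l, hl, rfl⟩
    simp only [Set.mem_ofPred_eq] at hl
    have hne : l ≠ [] := by
      rintro rfl
      simp at hl
      omega
    have hne' : l ++ flipWord (letterInversion κ) l ≠ [] := by simp [hne]
    have hw1 := hF.positiveWord_ne_one hne'
    rw [← hF.commutator_eq] at hw1
    set g := genA k * positiveWord (genA k) (genB k) l with hg
    have hgg : positiveWord (genA k) (genB k) (l ++ flipWord (letterInversion κ) l) =
        genA k * (g * genA k * g⁻¹) := by
      rw [← hF.commutator_eq, ← hg, hF.inv_a]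
      group
    have hconj : IsConj (genA k) (g * genA k * g⁻¹) := isConj_iff.2 ⟨g, rfl⟩
    refine ⟨⟨_, ⟨isHyperbolicElement_commutator hw1, genA k, g * genA k * g⁻¹, ?_, hconj,
      (isInvolutionOver_iff _).2 (IsConj.refl _), (isInvolutionOver_iff _).2 hconj, ?_⟩, ?_⟩, ?_⟩
    · intro h1
      apply hF.positiveWord_ne_one hne'
      rw [hgg, ← h1, hF.a_mul_a]
    · rw [hF.inv_a]
      group
    · rw [reciprocalClass, ← hF.commutator_eq]
    · rw [reciprocalClass, hF.classLength_positiveWord hne', weight_append, hF.weight_flipWord]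
      omega

/-! ### Polynomials with a single positive coefficient -/

section CharPoly

open Polynomial

/-- The polynomial `X ^ (m + 1) - ∑ p j * X ^ j`, the sum being over `j < m`. -/
def charPoly (p : ℕ → ℝ) (m : ℕ) : ℝ[X] :=
  X ^ (m + 1) - ∑ j ∈ Finset.range m, C (p j) * X ^ j

variable {p : ℕ → ℝ} {m : ℕ}

theorem charPoly_degree_lt (p : ℕ → ℝ) (m : ℕ) :
    (∑ j ∈ Finset.range m, C (p j) * X ^ j : ℝ[X]).degree < ((m + 1 : ℕ) : WithBot ℕ) := by
  refine (degree_sum_le _ _).trans_lt ?_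
  rw [Finset.sup_lt_iff (by exact_mod_cast WithBot.bot_lt_coe (m + 1))]
  intro j hj
  refine (degree_C_mul_X_pow_le _ _).trans_lt ?_
  have := Finset.mem_range.1 hj
  exact_mod_cast (by omega : j < m + 1)

theorem charPoly_monic (p : ℕ → ℝ) (m : ℕ) : (charPoly p m).Monic :=
  monic_X_pow_sub (charPoly_degree_lt p m)

theorem natDegree_charPoly (p : ℕ → ℝ) (m : ℕ) : (charPoly p m).natDegree = m + 1 := by
  apply natDegree_eq_of_degree_eq_some
  rw [charPoly, degree_sub_eq_left_of_degree_lt]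
  · rw [degree_X_pow]
  · rw [degree_X_pow]
    exact charPoly_degree_lt p m

theorem isRoot_charPoly_iff (x : ℝ) :
    (charPoly p m).IsRoot x ↔ x ^ (m + 1) = ∑ j ∈ Finset.range m, p j * x ^ j := by
  simp [charPoly, IsRoot.def, eval_finsetSum, sub_eq_zero]

theorem aeval_charPoly_eq_zero_iff (z : ℂ) :
    aeval z (charPoly p m) = 0 ↔ z ^ (m + 1) = ∑ j ∈ Finset.range m, (p j : ℂ) * z ^ j := by
  simp [charPoly, sub_eq_zero]

/-- The quotient of the lower terms by the leading term is decreasing. -/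
theorem pow_mul_sum_lt (hp : ∀ j < m, 0 < p j) (hm : 1 ≤ m) {x y : ℝ} (hx : 0 < x) (hxy : x < y) :
    x ^ (m + 1) * ∑ j ∈ Finset.range m, p j * y ^ j <
      y ^ (m + 1) * ∑ j ∈ Finset.range m, p j * x ^ j := by
  rw [Finset.mul_sum, Finset.mul_sum]
  refine Finset.sum_lt_sum_of_nonempty ⟨0, Finset.mem_range.2 hm⟩ fun j hj => ?_
  have hj := Finset.mem_range.1 hj
  have hy : 0 < y := hx.trans hxy
  have h1 : ∀ w : ℝ, w ^ (m + 1) = w ^ j * w ^ (m + 1 - j) := fun w => by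
    rw [← pow_add]; congr 1; omega
  have h2 : x ^ (m + 1 - j) < y ^ (m + 1 - j) := pow_lt_pow_left₀ hxy hx.le (by omega)
  have h3 : 0 < p j * x ^ j * y ^ j := by have := hp j hj; positivity
  rw [h1 x, h1 y]
  nlinarith

theorem exists_isUniquePositiveRoot (hp : ∀ j < m, 0 < p j) (hm : 2 ≤ m)
    (hsum : 1 < ∑ j ∈ Finset.range m, p j) :
    ∃ ρ : ℝ, IsUniquePositiveRoot (charPoly p m) ρ ∧ 1 < ρ := by
  set S := ∑ j ∈ Finset.range m, p j with hS
  have hcont : ContinuousOn (fun x => (charPoly p m).eval x) (Set.Icc 1 (1 + S)) :=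
    (charPoly p m).continuous.continuousOn
  have h1 : (charPoly p m).eval 1 < 0 := by
    simp [charPoly, eval_finsetSum]
    linarith
  have h2 : 0 < (charPoly p m).eval (1 + S) := by
    have h3 : ∑ j ∈ Finset.range m, p j * (1 + S) ^ j ≤ S * (1 + S) ^ m := by
      rw [hS, Finset.sum_mul]
      refine Finset.sum_le_sum fun j hj => ?_
      have hj := Finset.mem_range.1 hj
      have := hp j hj
      gcongr
      · linarith
    have h4 : 0 < (1 + S) ^ m := by positivity
    simp only [charPoly, eval_sub, eval_pow, eval_X, eval_finsetSum, eval_mul, eval_C]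
    rw [pow_succ]
    nlinarith
  obtain ⟨ρ, ⟨hρ1, -⟩, hρ⟩ := intermediate_value_Icc (by linarith) hcont ⟨h1.le, h2.le⟩
  have hρ1' : 1 < ρ := lt_of_le_of_ne hρ1 fun h => by
    subst h
    simp only at hρ
    linarith
  refine ⟨ρ, ⟨⟨by linarith, hρ⟩, fun x hx hroot => ?_⟩, hρ1'⟩
  have hρ' := isRoot_charPoly_iff ρ |>.1 hρ
  rw [isRoot_charPoly_iff] at hroot
  rcases lt_trichotomy x ρ with h | h | h
  · have := pow_mul_sum_lt hp (by omega) hx h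
    rw [← hρ', ← hroot] at this
    linarith [mul_comm (x ^ (m + 1)) (ρ ^ (m + 1))]
  · exact h
  · have := pow_mul_sum_lt hp (by omega) (by linarith) h
    rw [← hρ', ← hroot] at this
    linarith [mul_comm (x ^ (m + 1)) (ρ ^ (m + 1))]

/-- The positive root is simple, with positive derivative. -/
theorem eval_derivative_pos (hp : ∀ j < m, 0 < p j) (hm : 1 ≤ m) {x : ℝ} (hx : 0 < x)
    (hroot : (charPoly p m).IsRoot x) : 0 < (derivative (charPoly p m)).eval x := by
  rw [isRoot_charPoly_iff] at hroot
  have h1 : x * (derivative (charPoly p m)).eval x =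
      ∑ j ∈ Finset.range m, ((m : ℝ) + 1 - j) * (p j * x ^ j) := by
    have h2 : ∀ j : ℕ, x * (j * x ^ (j - 1)) = j * x ^ j := by
      rintro (_ | j)
      · simp
      · simp; ring
    have h3 : x * (derivative (charPoly p m)).eval x =
        ((m : ℝ) + 1) * x ^ (m + 1) - ∑ j ∈ Finset.range m, j * (p j * x ^ j) := by
      simp only [charPoly, derivative_sub, derivative_X_pow, derivative_sum, derivative_C_mul,
        eval_sub, eval_mul, eval_natCast, eval_pow, eval_X, eval_finsetSum, eval_C, map_natCast]
      rw [mul_sub, Finset.mul_sum]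
      congr 1
      · have h4 := h2 (m + 1)
        push_cast at h4 ⊢
        exact h4
      · refine Finset.sum_congr rfl fun j _ => ?_
        linear_combination p j * h2 j
    rw [h3, hroot, Finset.mul_sum, ← Finset.sum_sub_distrib]
    refine Finset.sum_congr rfl fun j _ => ?_
    ring
  have h3 : 0 < ∑ j ∈ Finset.range m, ((m : ℝ) + 1 - j) * (p j * x ^ j) := by
    refine Finset.sum_pos (fun j hj => ?_) ⟨0, Finset.mem_range.2 hm⟩
    have hj := Finset.mem_range.1 hj
    have := hp j hj
    have h4 : (j : ℝ) < m := by exact_mod_cast hj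
    have h5 : 0 < (m : ℝ) + 1 - j := by linarith
    positivity
  rw [← h1] at h3
  exact (pos_iff_pos_of_mul_pos h3).1 hx

/-- The positive root dominates the other complex roots. Equality in the triangle inequality
already fails for the terms of degrees `0` and `1`. -/
theorem norm_lt_of_root (hp : ∀ j < m, 0 < p j) (hm : 2 ≤ m) {ρ : ℝ} (hρ : 0 < ρ)
    (hroot : (charPoly p m).IsRoot ρ) {z : ℂ} (hz : aeval z (charPoly p m) = 0) (hne : z ≠ ρ) :
    ‖z‖ < ρ := by
  rw [isRoot_charPoly_iff] at hroot
  rw [aeval_charPoly_eq_zero_iff] at hz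
  have hterm : ∀ j ∈ Finset.range m, ‖(p j : ℂ) * z ^ j‖ = p j * ‖z‖ ^ j := by
    intro j hj
    have := hp j (Finset.mem_range.1 hj)
    rw [norm_mul, norm_pow, Complex.norm_real, Real.norm_of_nonneg this.le]
  have hz' := congrArg norm hz
  rw [norm_pow] at hz'
  rcases lt_trichotomy ‖z‖ ρ with h | h | h
  · exact h
  · exfalso
    obtain ⟨n, rfl⟩ := Nat.exists_eq_add_of_le hm
    have hp0 := hp 0 (by omega)
    have hp1 := hp 1 (by omega)
    have split : ∀ f : ℕ → ℂ, ∑ j ∈ Finset.range (2 + n), f j =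
        (f 0 + f 1) + ∑ j ∈ Finset.range n, f (2 + j) := by
      intro f
      rw [Finset.sum_range_add, Finset.sum_range_succ, Finset.sum_range_one]
    have split' : ∀ f : ℕ → ℝ, ∑ j ∈ Finset.range (2 + n), f j =
        (f 0 + f 1) + ∑ j ∈ Finset.range n, f (2 + j) := by
      intro f
      rw [Finset.sum_range_add, Finset.sum_range_succ, Finset.sum_range_one]
    have h1 : ‖∑ j ∈ Finset.range n, (p (2 + j) : ℂ) * z ^ (2 + j)‖ ≤
        ∑ j ∈ Finset.range n, p (2 + j) * ρ ^ (2 + j) := by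
      refine (norm_sum_le _ _).trans (Finset.sum_le_sum fun j hj => ?_)
      have hj := Finset.mem_range.1 hj
      rw [hterm (2 + j) (Finset.mem_range.2 (by omega)), h]
    rw [h, hroot, split, split'] at hz'
    have h2 := norm_add_le ((p 0 : ℂ) * z ^ 0 + (p 1 : ℂ) * z ^ 1)
      (∑ j ∈ Finset.range n, (p (2 + j) : ℂ) * z ^ (2 + j))
    have h3 : p 0 + p 1 * ρ ≤ ‖(p 0 : ℂ) + (p 1 : ℂ) * z‖ := by
      simp only [pow_zero, mul_one, pow_one] at hz' h2
      linarith
    have h4 : (p 0 + p 1 * ρ) ^ 2 ≤ ‖(p 0 : ℂ) + (p 1 : ℂ) * z‖ ^ 2 :=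
      pow_le_pow_left₀ (by positivity) h3 2
    have h5 : ρ ^ 2 = z.re ^ 2 + z.im ^ 2 := by
      rw [← h, Complex.sq_norm, Complex.normSq_apply]; ring
    rw [Complex.sq_norm, Complex.normSq_apply] at h4
    simp at h4
    have h6 : ρ ≤ z.re := by
      have h7 : 0 < p 0 * p 1 := mul_pos hp0 hp1
      by_contra! hlt
      have h8 : p 1 ^ 2 * ρ ^ 2 = p 1 ^ 2 * (z.re ^ 2 + z.im ^ 2) := by rw [h5]
      nlinarith [mul_pos h7 (sub_pos.2 hlt)]
    have h7 : z.im = 0 := by nlinarith [sq_nonneg z.im]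
    have h8 : z.re = ρ := by
      rw [h7] at h5
      nlinarith
    exact hne (Complex.ext (by simpa using h8) (by simpa using h7))
  · exfalso
    have h1 := pow_mul_sum_lt hp (by omega) hρ h
    have h2 : ‖z‖ ^ (m + 1) ≤ ∑ j ∈ Finset.range m, p j * ‖z‖ ^ j := by
      rw [hz']
      exact (norm_sum_le _ _).trans (Finset.sum_le_sum fun j hj => (hterm j hj).le)
    rw [← hroot] at h1
    have h3 : 0 < ρ ^ (m + 1) := by positivity
    nlinarith

/-! ### Linear recurrences with simple characteristic roots -/

/-- The distinct complex roots. -/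
def complexRoots (p : ℕ → ℝ) (m : ℕ) : Finset ℂ :=
  ((charPoly p m).rootSet_finite ℂ).toFinset

theorem mem_complexRoots (z : ℂ) : z ∈ complexRoots p m ↔ aeval z (charPoly p m) = 0 := by
  simp [complexRoots, mem_rootSet, (charPoly_monic p m).ne_zero]

/-- If all roots are simple, the polynomial is the product of `X - z` over the roots `z`. -/
theorem map_charPoly_eq_nodal (hsimple : ∀ z : ℂ, aeval z (charPoly p m) = 0 →
      aeval z (derivative (charPoly p m)) ≠ 0) :
    (charPoly p m).map (algebraMap ℝ ℂ) = Lagrange.nodal (complexRoots p m) id := by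
  classical
  set P := (charPoly p m).map (algebraMap ℝ ℂ) with hP
  have hmonic : P.Monic := (charPoly_monic p m).map _
  have hnodup : P.roots.Nodup := by
    rw [Multiset.nodup_iff_count_le_one]
    intro z
    rw [count_roots]
    by_contra! hlt
    rw [one_lt_rootMultiplicity_iff_isRoot hmonic.ne_zero] at hlt
    obtain ⟨h1, h2⟩ := hlt
    rw [hP, derivative_map] at h2
    rw [IsRoot.def, hP, eval_map_algebraMap] at h1
    rw [IsRoot.def, eval_map_algebraMap] at h2
    exact hsimple z h1 h2
  have hroots : P.roots = (complexRoots p m).val := by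
    have : complexRoots p m = P.roots.toFinset := by
      ext z
      rw [mem_complexRoots, Multiset.mem_toFinset, mem_roots hmonic.ne_zero, IsRoot.def, hP,
        eval_map_algebraMap]
    rw [this, Multiset.toFinset_val, Multiset.dedup_eq_self.2 hnodup]
  have hsplit : (P.roots.map fun a => X - C a).prod = P := by
    have := (IsAlgClosed.splits P).eq_prod_roots
    rw [hmonic.leadingCoeff, C_1, one_mul] at this
    exact this.symm
  rw [← hsplit, hroots, Lagrange.nodal_eq]
  rfl

/-- The coefficient of `z ^ t` in the solution of the recurrence. -/
def rootCoefficient (p : ℕ → ℝ) (m : ℕ) (z : ℂ) : ℂ :=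
  z ^ m / aeval z (derivative (charPoly p m))

/-- A solution of the recurrence attached to a polynomial with simple roots, with initial values
`0, …, 0, 1`, is a combination of powers of the roots. The initial values are matched by Lagrange
interpolation of `X ^ s` at the roots. -/
theorem eq_sum_rootCoefficient (hsimple : ∀ z : ℂ, aeval z (charPoly p m) = 0 →
      aeval z (derivative (charPoly p m)) ≠ 0)
    {N : ℕ → ℕ} {e : ℕ → ℕ} (h0 : N 0 = 1)
    (hN : ∀ t, N (t + 1) = ∑ j ∈ Finset.range (t + 1), e j * N (t - j))
    (he0 : e 0 = 0) (he : ∀ j < m, (e (j + 1) : ℝ) = p (m - 1 - j)) (he' : ∀ j, m < j → e j = 0)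
    (t : ℕ) : (N t : ℂ) = ∑ z ∈ complexRoots p m, rootCoefficient p m z * z ^ t := by
  classical
  set Z := complexRoots p m with hZ
  have hnodal := map_charPoly_eq_nodal hsimple
  have hcard : Z.card = m + 1 := by
    have := congrArg natDegree hnodal
    rw [Lagrange.natDegree_nodal, natDegree_map, natDegree_charPoly] at this
    exact this.symm
  have hder : ∀ z ∈ Z, aeval z (derivative (charPoly p m)) = ∏ w ∈ Z.erase z, (z - w) := by
    intro z hz
    have := Lagrange.eval_nodal_derivative_eval_node_eq (v := id) hz
    rw [← hnodal, derivative_map, id, eval_map_algebraMap, Lagrange.eval_nodal] at this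
    exact this
  set H : ℕ → ℂ := fun s => ∑ z ∈ Z, z ^ s / aeval z (derivative (charPoly p m)) with hH
  have hinit : ∀ s ≤ m, H s = if s = m then 1 else 0 := by
    intro s hs
    have h1 := Lagrange.coeff_eq_sum (s := Z) (v := id) Function.injective_id.injOn
      (P := (X ^ s : ℂ[X])) (by
        rw [degree_X_pow, hcard]
        exact_mod_cast (by omega : s < m + 1))
    rw [hcard, Nat.add_sub_cancel, coeff_X_pow] at h1
    simp only [hH]
    rw [Finset.sum_congr rfl fun z hz => by rw [hder z hz]]
    simp only [eval_pow, eval_X, id] at h1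
    rw [← h1]
    simp [eq_comm]
  have hrec : ∀ s, H (s + (m + 1)) = ∑ j ∈ Finset.range m, (p j : ℂ) * H (s + j) := by
    intro s
    simp only [hH, Finset.mul_sum]
    rw [Finset.sum_comm]
    refine Finset.sum_congr rfl fun z hz => ?_
    rw [pow_add, (aeval_charPoly_eq_zero_iff z).1 ((mem_complexRoots z).1 hz), Finset.mul_sum,
      Finset.sum_div]
    refine Finset.sum_congr rfl fun j _ => ?_
    rw [pow_add]
    ring
  have hNH : ∀ t, (N t : ℂ) = H (t + m) := by
    intro t
    induction t using Nat.strong_induction_on with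
    | _ t ih =>
      rcases t with _ | t
      · rw [h0, zero_add, hinit m le_rfl]
        simp
      · rw [show t + 1 + m = t + (m + 1) by ring, hrec, hN, Finset.sum_range_succ', he0, zero_mul,
          add_zero, ← Finset.sum_range_reflect (fun j => (p j : ℂ) * H (t + j)) m]
        push_cast
        -- both sums are supported on the indices below `min t m`
        have hl : ∑ j ∈ Finset.range t, (e (j + 1) : ℂ) * (N (t - (j + 1)) : ℂ) =
            ∑ j ∈ Finset.range (min t m), (e (j + 1) : ℂ) * (N (t - (j + 1)) : ℂ) := by
          symm
          refine Finset.sum_subset (Finset.range_subset_range.2 (min_le_left _ _))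
            fun j hj hj' => ?_
          simp only [Finset.mem_range] at hj hj'
          rw [he' (j + 1) (by omega)]
          simp
        have hr : ∑ j ∈ Finset.range m, (p (m - 1 - j) : ℂ) * H (t + (m - 1 - j)) =
            ∑ j ∈ Finset.range (min t m), (p (m - 1 - j) : ℂ) * H (t + (m - 1 - j)) := by
          symm
          refine Finset.sum_subset (Finset.range_subset_range.2 (min_le_right _ _))
            fun j hj hj' => ?_
          simp only [Finset.mem_range] at hj hj'
          rw [hinit _ (by omega), if_neg (by omega), mul_zero]
        rw [hl, hr]
        refine Finset.sum_congr rfl fun j hj => ?_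
        simp only [Finset.mem_range] at hj
        rw [ih _ (by omega), ← he j (by omega), Complex.ofReal_natCast]
        congr 2
        omega
  rw [hNH]
  refine Finset.sum_congr rfl fun z _ => ?_
  rw [rootCoefficient, pow_add]
  ring

open Filter Topology in
/-- Only the positive root contributes to the growth. -/
theorem exists_coefficient_and_tendsto (hp : ∀ j < m, 0 < p j) (hm : 2 ≤ m)
    (hsimple : ∀ z : ℂ, aeval z (charPoly p m) = 0 → aeval z (derivative (charPoly p m)) ≠ 0)
    {N : ℕ → ℕ} {e : ℕ → ℕ} (h0 : N 0 = 1)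
    (hN : ∀ t, N (t + 1) = ∑ j ∈ Finset.range (t + 1), e j * N (t - j))
    (he0 : e 0 = 0) (he : ∀ j < m, (e (j + 1) : ℝ) = p (m - 1 - j)) (he' : ∀ j, m < j → e j = 0)
    {ρ : ℝ} (hρ : IsUniquePositiveRoot (charPoly p m) ρ) :
    ∃ c : ℝ, 0 < c ∧ rootCoefficient p m ρ = c ∧
      Tendsto (fun t : ℕ => (N t : ℝ) / ρ ^ t) atTop (𝓝 c) := by
  have hρ0 := hρ.1.1
  have hder := eval_derivative_pos hp (by omega) hρ0 hρ.1.2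
  set c := ρ ^ m / (derivative (charPoly p m)).eval ρ with hc
  have haeval : ∀ P : ℝ[X], aeval (ρ : ℂ) P = ((P.eval ρ : ℝ) : ℂ) := fun P => by
    simpa using aeval_algebraMap_apply ℂ ρ P
  have hcoef : rootCoefficient p m ρ = c := by
    rw [rootCoefficient, haeval, hc]
    push_cast
    rfl
  refine ⟨c, by positivity, hcoef, ?_⟩
  have hmem : (ρ : ℂ) ∈ complexRoots p m := by
    rw [mem_complexRoots, haeval, hρ.1.2.eq_zero, Complex.ofReal_zero]
  have hlim : Tendsto (fun t : ℕ => ((N t : ℂ) / (ρ : ℂ) ^ t)) atTop (𝓝 (c : ℂ)) := by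
    have h1 : ∀ t, (N t : ℂ) / (ρ : ℂ) ^ t =
        ∑ z ∈ complexRoots p m, rootCoefficient p m z * (z / ρ) ^ t := by
      intro t
      rw [eq_sum_rootCoefficient hsimple h0 hN he0 he he' t, Finset.sum_div]
      refine Finset.sum_congr rfl fun z _ => ?_
      rw [div_pow, mul_div_assoc]
    simp only [h1]
    have h2 : (c : ℂ) = ∑ z ∈ complexRoots p m, if z = ρ then (c : ℂ) else 0 := by
      rw [Finset.sum_ite_eq' _ _ fun _ => (c : ℂ), if_pos hmem]
    rw [h2]
    refine tendsto_finsetSum _ fun z hz => ?_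
    have hρ' : (ρ : ℂ) ≠ 0 := by exact_mod_cast hρ0.ne'
    split_ifs with h
    · rw [h, hcoef, div_self hρ']
      simp
    · have h3 : ‖z / (ρ : ℂ)‖ < 1 := by
        rw [norm_div, Complex.norm_real, Real.norm_of_nonneg hρ0.le, div_lt_one hρ0]
        exact norm_lt_of_root hp hm hρ0 hρ.1.2 ((mem_complexRoots z).1 hz) h
      simpa using (tendsto_pow_atTop_nhds_zero_of_norm_lt_one h3).const_mul (rootCoefficient p m z)
  have := (Complex.continuous_re.tendsto _).comp hlim
  simp only [Complex.ofReal_re] at this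
  refine this.congr fun t => ?_
  simp only [Function.comp]
  rw [← Complex.ofReal_pow, ← Complex.ofReal_natCast, ← Complex.ofReal_div, Complex.ofReal_re]

end CharPoly

/-! ### Recurrence for the number of words -/

/-- The number of letters of absolute value `j`. -/
def letterCount (E : Set ℤ) (j : ℕ) : ℕ :=
  {x : ℤ | x ∈ E ∧ x.natAbs = j}.ncard

theorem card_wordsOfWeight_zero (E : Set ℤ) : (wordsOfWeight E 0).card = 1 := by
  rw [Finset.card_eq_one]
  refine ⟨[], ?_⟩
  ext l
  rw [mem_wordsOfWeight, Finset.mem_singleton]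
  constructor
  · intro h
    have := length_le_weight l
    exact List.length_eq_zero_iff.1 (by omega)
  · rintro rfl
    rfl

/-- Sorting the words by the absolute value `j` of their first letter. -/
theorem card_wordsOfWeight_succ (E : Set ℤ) (t : ℕ) :
    (wordsOfWeight E (t + 1)).card =
      ∑ j ∈ Finset.range (t + 1), letterCount E j * (wordsOfWeight E (t - j)).card := by
  classical
  have hS : ∀ j : ℕ, {x : E | (x : ℤ).natAbs = j}.Finite := fun j =>
    Set.Finite.of_finite_image (f := Subtype.val) ((Set.finite_Icc (-(j : ℤ)) j).subset (by
      rintro _ ⟨x, hx, rfl⟩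
      simp only [Set.mem_ofPred_eq] at hx
      simp only [Set.mem_Icc]; omega)) Subtype.val_injective.injOn
  have hcount : ∀ j, letterCount E j = (hS j).toFinset.card := by
    intro j
    rw [letterCount, ← Set.ncard_eq_toFinset_card _ (hS j),
      ← Set.ncard_image_of_injective _ (Subtype.val_injective (p := (· ∈ E)))]
    congr 1
    ext x
    simp [and_comm]
  have hsplit : wordsOfWeight E (t + 1) = (Finset.range (t + 1)).biUnion fun j =>
      Finset.image₂ List.cons (hS j).toFinset (wordsOfWeight E (t - j)) := by
    ext l
    simp only [mem_wordsOfWeight, Finset.mem_biUnion, Finset.mem_range, Finset.mem_image₂,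
      Set.Finite.mem_toFinset, Set.mem_ofPred_eq]
    constructor
    · intro hl
      rcases l with _ | ⟨x, l⟩
      · simp at hl
      · rw [weight_cons] at hl
        exact ⟨_, by omega, x, rfl, l, by omega, rfl⟩
    · rintro ⟨j, hj, x, hx, l, hl, rfl⟩
      rw [weight_cons]
      omega
  rw [hsplit, Finset.card_biUnion]
  · refine Finset.sum_congr rfl fun j _ => ?_
    rw [hcount, Finset.card_image₂ fun _ _ _ _ hab => List.cons.inj hab]
  · intro i _ j _ hij
    rw [Function.onFun, Finset.disjoint_left]
    intro l hl hl'
    obtain ⟨x, hx, l, -, rfl⟩ := Finset.mem_image₂.1 hl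
    obtain ⟨y, hy, l', -, hyx⟩ := Finset.mem_image₂.1 hl'
    simp only [Set.Finite.mem_toFinset, Set.mem_ofPred_eq] at hx hy
    rw [List.cons.injEq] at hyx
    apply hij
    rw [← hx, ← hy, hyx.1]

theorem letterCount_eq_two {E : Set ℤ} {j : ℕ} (hj : 1 ≤ j) (h1 : (j : ℤ) ∈ E)
    (h2 : -(j : ℤ) ∈ E) : letterCount E j = 2 := by
  have : {x : ℤ | x ∈ E ∧ x.natAbs = j} = {(j : ℤ), -(j : ℤ)} := by
    ext x
    simp only [Set.mem_ofPred_eq, Set.mem_insert_iff, Set.mem_singleton_iff]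
    constructor
    · rintro ⟨-, h⟩; omega
    · rintro (rfl | rfl)
      · exact ⟨h1, by simp⟩
      · exact ⟨h2, by simp⟩
  rw [letterCount, this, Set.ncard_pair (by omega)]

theorem letterCount_eq_one {E : Set ℤ} {j : ℕ} (h1 : (j : ℤ) ∈ E) (h2 : -(j : ℤ) ∉ E) :
    letterCount E j = 1 := by
  have : {x : ℤ | x ∈ E ∧ x.natAbs = j} = {(j : ℤ)} := by
    ext x
    simp only [Set.mem_ofPred_eq, Set.mem_singleton_iff]
    constructor
    · rintro ⟨hx, h⟩
      rcases Int.natAbs_eq x with h3 | h3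
      · omega
      · rw [h] at h3
        exact absurd (h3 ▸ hx) h2
    · rintro rfl
      exact ⟨h1, by simp⟩
  rw [letterCount, this, Set.ncard_singleton]

theorem letterCount_eq_zero {E : Set ℤ} {j : ℕ} (h : ∀ x ∈ E, x.natAbs ≠ j) :
    letterCount E j = 0 := by
  have : {x : ℤ | x ∈ E ∧ x.natAbs = j} = ∅ := by
    ext x
    simpa using h x
  rw [letterCount, this, Set.ncard_empty]

/-! ### The polynomials of the theorem -/

section Polynomials

open Polynomial

/-- The coefficients `q, 2, 2, …`. -/
def lowerCoeff (q : ℝ) (j : ℕ) : ℝ := if j = 0 then q else 2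

theorem sum_lowerCoeff_mul {R : Type*} [CommRing R] (f : ℝ → R) (q : ℝ) {m : ℕ} (hm : 1 ≤ m)
    (g : ℕ → R) : ∑ j ∈ Finset.range m, f (lowerCoeff q j) * g j =
      f q * g 0 + ∑ j ∈ Finset.Icc 1 (m - 1), f 2 * g j := by
  obtain ⟨n, rfl⟩ := Nat.exists_eq_add_of_le' hm
  rw [Finset.sum_range_succ', add_comm]
  congr 1
  rw [Nat.add_sub_cancel, Finset.range_eq_Ico, 
    Finset.sum_Ico_add' (fun j => f (lowerCoeff q j) * g j) 0 n 1]
  refine Finset.sum_congr (by ext; simp) fun j hj => ?_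
  rw [lowerCoeff, if_neg (by simp at hj; omega)]

theorem oddPoly_eq {m : ℕ} (hm : 1 ≤ m) : oddPoly m = charPoly (lowerCoeff 2) m := by
  rw [oddPoly, charPoly]
  congr 1
  refine Finset.sum_congr (by ext; simp; omega) fun j _ => ?_
  rw [lowerCoeff, ite_self]
  rfl

theorem evenPoly_eq {m : ℕ} (hm : 1 ≤ m) : evenPoly m = charPoly (lowerCoeff 1) m := by
  rw [evenPoly, charPoly, sum_lowerCoeff_mul C 1 hm fun j => (X : ℝ[X]) ^ j]
  simp only [C_1, C_ofNat]
  ring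

/-- Multiplication by `X - 1` leaves few terms. -/
theorem X_sub_one_mul_charPoly (q : ℝ) {m : ℕ} (hm : 1 ≤ m) :
    (X - 1) * charPoly (lowerCoeff q) m =
      X ^ (m + 2) - X ^ (m + 1) - (X ^ m + X ^ m) + C (2 - q) * X + C q := by
  have h1 : ∑ j ∈ Finset.range m, C (lowerCoeff q j) * X ^ j =
      2 * (∑ j ∈ Finset.range m, X ^ j) + C (q - 2) := by
    obtain ⟨n, rfl⟩ := Nat.exists_eq_add_of_le' hm
    rw [Finset.sum_range_succ', Finset.sum_range_succ', mul_add, Finset.mul_sum]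
    simp only [lowerCoeff, Nat.succ_ne_zero, if_false, if_true, pow_zero, mul_one, map_sub, C_ofNat]
    ring
  rw [charPoly, h1, mul_sub, mul_add]
  have h2 := mul_geom_sum (X : ℝ[X]) m
  simp only [map_sub, C_ofNat]
  linear_combination -2 * h2

theorem lowerCoeff_pos {q : ℝ} (hq : 0 < q) (j : ℕ) : 0 < lowerCoeff q j := by
  unfold lowerCoeff
  split_ifs <;> positivity

/-- A multiple root `z` is a common zero of `X - 1` times the polynomial and its derivative. -/
theorem multipleRoot_equations (q : ℝ) {m : ℕ} (hm : 1 ≤ m) {z : ℂ}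
    (h1 : aeval z (charPoly (lowerCoeff q) m) = 0)
    (h2 : aeval z (derivative (charPoly (lowerCoeff q) m)) = 0) :
    z ^ (m + 2) - z ^ (m + 1) - 2 * z ^ m + (2 - q) * z + q = 0 ∧
      (m + 2) * z ^ (m + 1) - (m + 1) * z ^ m - 2 * (m * z ^ (m - 1)) + (2 - q) = 0 := by
  have hQ := X_sub_one_mul_charPoly q hm
  constructor
  · have := congrArg (aeval z) hQ
    simp only [map_mul, h1, mul_zero] at this
    simp at this
    linear_combination -this
  · have := congrArg (fun P => aeval z (derivative P)) hQ
    simp only [derivative_mul, map_add, map_mul, h1, h2, mul_zero, add_zero] at this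
    simp [derivative_X_pow] at this
    linear_combination -this

/-- A multiple root is not a positive real. -/
theorem ne_ofReal_of_multipleRoot {q : ℝ} (hq : 0 < q) {m : ℕ} (hm : 1 ≤ m) {z : ℂ}
    (h1 : aeval z (charPoly (lowerCoeff q) m) = 0)
    (h2 : aeval z (derivative (charPoly (lowerCoeff q) m)) = 0) {x : ℝ} (hx : 0 < x) :
    z ≠ x := by
  rintro rfl
  have haeval : ∀ P : ℝ[X], aeval (x : ℂ) P = ((P.eval x : ℝ) : ℂ) := fun P => by
    simpa using aeval_algebraMap_apply ℂ x P
  rw [haeval, Complex.ofReal_eq_zero] at h1 h2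
  have := eval_derivative_pos (fun j _ => lowerCoeff_pos hq j) hm hx h1
  linarith

theorem simple_roots_one {m : ℕ} (hm : 2 ≤ m) (z : ℂ)
    (h1 : aeval z (charPoly (lowerCoeff 1) m) = 0) :
    aeval z (derivative (charPoly (lowerCoeff 1) m)) ≠ 0 := by
  intro h2
  obtain ⟨e1, e2⟩ := multipleRoot_equations 1 (by omega) h1 h2
  obtain ⟨n, rfl⟩ := Nat.exists_eq_add_of_le' (by omega : 1 ≤ m)
  simp only [Nat.add_sub_cancel] at e2
  push_cast at e1 e2
  -- the equations are those of `(z + 1) * (z ^ m * (z - 2) + 1)`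
  have f1 : (z + 1) * (z ^ (n + 1) * (z - 2) + 1) = 0 := by linear_combination e1
  have f2 : (z ^ (n + 1) * (z - 2) + 1) + (z + 1) * (z ^ n * ((n + 2) * z - 2 * (n + 1))) = 0 := by
    linear_combination e2
  by_cases hz : z + 1 = 0
  · rw [hz, zero_mul, add_zero, eq_neg_of_add_eq_zero_left hz] at f2
    rcases neg_one_pow_eq_or ℂ (n + 1) with h | h <;> rw [h] at f2 <;> norm_num at f2
  · rw [mul_eq_zero, or_iff_right hz] at f1
    rw [f1, zero_add, mul_eq_zero, or_iff_right hz, mul_eq_zero] at f2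
    rcases f2 with h | h
    · rw [pow_succ, h] at f1
      simp at f1
    · have hn : (n : ℂ) + 2 ≠ 0 := by exact_mod_cast (by omega : n + 2 ≠ 0)
      apply ne_ofReal_of_multipleRoot one_pos (by omega) h1 h2
        (x := 2 * (n + 1) / (n + 2)) (by positivity)
      push_cast
      rw [eq_div_iff hn]
      linear_combination h

theorem simple_roots_two {m : ℕ} (hm : 2 ≤ m) (z : ℂ)
    (h1 : aeval z (charPoly (lowerCoeff 2) m) = 0) :
    aeval z (derivative (charPoly (lowerCoeff 2) m)) ≠ 0 := by
  intro h2
  obtain ⟨e1, e2⟩ := multipleRoot_equations 2 (by omega) h1 h2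
  obtain ⟨n, rfl⟩ := Nat.exists_eq_add_of_le' (by omega : 1 ≤ m)
  simp only [Nat.add_sub_cancel] at e2
  push_cast at e1 e2
  have f1 : z ^ (n + 1) * (z ^ 2 - z - 2) = -2 := by linear_combination e1
  have f2 : z ^ n * ((n + 3) * z ^ 2 - (n + 2) * z - 2 * (n + 1)) = 0 := by linear_combination e2
  rcases mul_eq_zero.1 f2 with h | h
  · rw [pow_succ, h] at f1
    simp at f1
  -- the quadratic factor has real roots only
  have hre := congrArg Complex.re h
  have him := congrArg Complex.im h
  simp [pow_two] at hre him
  have hn : (0 : ℝ) ≤ n := by positivity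
  have hy : z.im = 0 := by
    have h3 : z.im * (2 * (n + 3) * z.re - (n + 2)) = 0 := by linear_combination him
    rcases mul_eq_zero.1 h3 with h4 | h4
    · exact h4
    · exfalso
      have h5 : z.re * (2 * (n + 3) * z.re - (n + 2)) = 0 := by rw [h4, mul_zero]
      nlinarith [sq_nonneg z.im, sq_nonneg z.re, mul_nonneg hn (sq_nonneg z.re),
        mul_nonneg hn (sq_nonneg z.im)]
  have hzx : z = (z.re : ℂ) := Complex.ext rfl (by simpa using hy)
  set x := z.re with hx
  rw [hy] at hre
  have hq : (n + 3) * x ^ 2 - (n + 2) * x - 2 * (n + 1) = 0 := by linear_combination hre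
  rw [hzx] at f1
  have f1 : x ^ (n + 1) * (x ^ 2 - x - 2) = -2 := by exact_mod_cast f1
  rcases lt_trichotomy x 0 with h3 | h3 | h3
  · have h4 : -1 < x := by
      by_contra! hle
      have h5 : 1 ≤ x ^ 2 := by nlinarith
      nlinarith [mul_nonneg hn (sub_nonneg.2 h5), mul_nonneg hn (by linarith : 0 ≤ -1 - x)]
    have h5 : |x ^ (n + 1)| ≤ 1 := by
      rw [abs_pow]
      exact pow_le_one₀ (abs_nonneg x) (abs_le.2 ⟨h4.le, by linarith⟩)
    have h6 : |x ^ 2 - x - 2| < 2 := by rw [abs_lt]; constructor <;> nlinarith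
    have h7 : |x ^ (n + 1) * (x ^ 2 - x - 2)| = 2 := by rw [f1]; norm_num
    rw [abs_mul] at h7
    nlinarith [abs_nonneg (x ^ (n + 1)), abs_nonneg (x ^ 2 - x - 2)]
  · rw [h3] at f1
    simp at f1
  · exact ne_ofReal_of_multipleRoot two_pos (by omega) h1 h2 h3 hzx

end Polynomials

/-! ### Growth of the number of reciprocal geodesics -/

open Filter Topology in
theorem hasReciprocalAsymptotics {k : ℕ∞} {κ : ℕ} (h : HasPositivePowers k κ) {ρ c : ℝ}
    (hρ : 1 < ρ) (hc : Tendsto (fun t : ℕ => ((wordsOfWeight (reducedExponents κ) t).card : ℝ) /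
      ρ ^ t) atTop (𝓝 c)) : HasReciprocalAsymptotics k (conePointTwo k) ρ (c / 2) :=
  h.isFreePair.tendsto_ncard_reciprocalClass (finite_setOf_letterInversion_eq κ) hρ hc
    (fun _ ht => reciprocalGeodesics_eq h ht) fun _ => rfl

theorem mem_reducedExponents_iff_of_pos {κ : ℕ} (hκ : 0 < κ) {x : ℤ} : x ∈ reducedExponents κ ↔
    x ≠ 0 ∧ -(((κ : ℤ) - 1) / 2) ≤ x ∧ x ≤ (κ : ℤ) / 2 := by
  rw [mem_reducedExponents_iff, or_iff_right hκ.ne']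

theorem exists_growth_of_letterCount {κ m : ℕ} (hκ : 3 ≤ κ) (hm : 2 ≤ m) {q : ℝ} (hq : 0 < q)
    (hsimple : ∀ z : ℂ, Polynomial.aeval z (charPoly (lowerCoeff q) m) = 0 →
      Polynomial.aeval z (Polynomial.derivative (charPoly (lowerCoeff q) m)) ≠ 0)
    (he : ∀ j < m, (letterCount (reducedExponents κ) (j + 1) : ℝ) = lowerCoeff q (m - 1 - j))
    (he' : ∀ j, m < j → letterCount (reducedExponents κ) j = 0) :
    ∃ ρ c : ℝ, IsUniquePositiveRoot (charPoly (lowerCoeff q) m) ρ ∧ 0 < c ∧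
      IsCoefficientOf (charPoly (lowerCoeff q) m) (normalFormCount κ) ρ c ∧
      HasReciprocalAsymptotics (κ : ℕ∞) (conePointTwo (κ : ℕ∞)) ρ (c / 2) := by
  have hpos := hasPositivePowers_natCast hκ
  have hp : ∀ j < m, 0 < lowerCoeff q j := fun j _ => lowerCoeff_pos hq j
  have hsum : 1 < ∑ j ∈ Finset.range m, lowerCoeff q j := by
    have h1 := Finset.single_le_sum (f := lowerCoeff q) (fun j _ => (lowerCoeff_pos hq j).le)
      (Finset.mem_range.2 (by omega : 1 < m))
    have h2 : lowerCoeff q 1 = 2 := rfl.trans (if_neg one_ne_zero)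
    linarith
  have he0 : letterCount (reducedExponents κ) 0 = 0 := letterCount_eq_zero fun x hx => by
    have := (mem_reducedExponents_iff.1 hx).1
    omega
  obtain ⟨ρ, hρ, hρ1⟩ := exists_isUniquePositiveRoot hp hm hsum
  obtain ⟨c, hc, hcoef, hlim⟩ := exists_coefficient_and_tendsto hp hm hsimple
    (N := fun t => (wordsOfWeight (reducedExponents κ) t).card)
    (card_wordsOfWeight_zero _) (card_wordsOfWeight_succ _) he0 he he' hρ
  refine ⟨ρ, c, hρ, hc, ⟨rootCoefficient (lowerCoeff q) m, hcoef, fun t ht => ?_⟩,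
    hasReciprocalAsymptotics hpos hρ1 hlim⟩
  have h1 : normalFormCount κ t = (wordsOfWeight (reducedExponents κ) t).card := by
    rw [← hpos.isFreePair.ncard_normalForms ht, normalFormCount, reducedExponents,
      if_neg (by omega)]
  rw [h1]
  exact eq_sum_rootCoefficient hsimple
    (N := fun t => (wordsOfWeight (reducedExponents κ) t).card)
    (card_wordsOfWeight_zero _) (card_wordsOfWeight_succ _) he0 he he' t

/-- For infinite order there are two letters of each positive absolute value. -/
theorem card_wordsOfWeight_infinite (t : ℕ) :
    ((wordsOfWeight (reducedExponents 0) t).card : ℝ) = (2 ^ t + 2 * (-1) ^ t) / 3 := by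
  set N : ℕ → ℕ := fun t => (wordsOfWeight (reducedExponents 0) t).card with hN
  have hsucc : ∀ t, N (t + 1) = 2 * ∑ i ∈ Finset.range t, N i := by
    intro t
    have h0 : letterCount (reducedExponents 0) 0 = 0 := letterCount_eq_zero fun x hx => by
      have := (mem_reducedExponents_iff.1 hx).1
      omega
    have h2 : ∀ j, letterCount (reducedExponents 0) (j + 1) = 2 := fun j =>
      letterCount_eq_two (by omega) (mem_reducedExponents_iff.2 (by omega))
        (mem_reducedExponents_iff.2 (by omega))
    simp only [hN]
    rw [card_wordsOfWeight_succ, Finset.sum_range_succ', h0, zero_mul, add_zero, Finset.mul_sum,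
      ← Finset.sum_range_reflect]
    refine Finset.sum_congr rfl fun j hj => ?_
    have := Finset.mem_range.1 hj
    rw [h2]
    congr 3
    omega
  have key : ∀ t, (N t : ℝ) = (2 ^ t + 2 * (-1) ^ t) / 3 ∧
      (N (t + 1) : ℝ) = (2 ^ (t + 1) + 2 * (-1) ^ (t + 1)) / 3 := by
    intro t
    induction t with
    | zero =>
      have h0 : N 0 = 1 := card_wordsOfWeight_zero _
      rw [h0, hsucc]
      norm_num
    | succ t ih =>
      refine ⟨ih.2, ?_⟩
      have h1 : N (t + 1 + 1) = N (t + 1) + 2 * N t := by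
        rw [hsucc (t + 1), hsucc t, Finset.sum_range_succ]
        ring
      rw [h1]
      push_cast
      rw [ih.1, ih.2]
      ring
  exact (key t).1

open Filter Topology in
theorem hasReciprocalAsymptotics_top :
    HasReciprocalAsymptotics ⊤ (conePointTwo ⊤) 2 (1 / 6) := by
  rw [show (1 / 6 : ℝ) = 1 / 3 / 2 by norm_num]
  refine hasReciprocalAsymptotics hasPositivePowers_top one_lt_two ?_
  have h1 : ∀ t : ℕ, ((wordsOfWeight (reducedExponents 0) t).card : ℝ) / 2 ^ t =
      1 / 3 + 2 / 3 * (-1 / 2) ^ t := by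
    intro t
    rw [card_wordsOfWeight_infinite, div_pow]
    field_simp
  simp only [h1]
  have h2 : Tendsto (fun t : ℕ => (-1 / 2 : ℝ) ^ t) atTop (𝓝 0) :=
    tendsto_pow_atTop_nhds_zero_of_abs_lt_one (by rw [abs_lt]; constructor <;> norm_num)
  have h3 := (h2.const_mul (2 / 3)).const_add (1 / 3)
  rwa [mul_zero, add_zero] at h3

end

theorem theoremA :
    (∀ m : ℕ, 2 ≤ m → ∃ α c : ℝ, IsUniquePositiveRoot (oddPoly m) α ∧ 0 < c ∧
      IsCoefficientOf (oddPoly m) (normalFormCount (2 * m + 1)) α c ∧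
      HasReciprocalAsymptotics ((2 * m + 1 : ℕ) : ℕ∞) (conePointTwo ((2 * m + 1 : ℕ) : ℕ∞))
        α (c / 2)) ∧
    (∀ m : ℕ, 2 ≤ m → ∃ β d : ℝ, IsUniquePositiveRoot (evenPoly m) β ∧ 0 < d ∧
      IsCoefficientOf (evenPoly m) (normalFormCount (2 * m)) β d ∧
      HasReciprocalAsymptotics ((2 * m : ℕ) : ℕ∞) (conePointTwo ((2 * m : ℕ) : ℕ∞))
        β (d / 2)) ∧
    HasReciprocalAsymptotics ⊤ (conePointTwo ⊤) 2 (1 / 6) := by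
  refine ⟨fun m hm => ?_, fun m hm => ?_, hasReciprocalAsymptotics_top⟩
  · rw [oddPoly_eq (by omega)]
    refine exists_growth_of_letterCount (by omega) hm two_pos (simple_roots_two hm)
      (fun j hj => ?_) fun j hj => ?_
    · rw [lowerCoeff, ite_self, letterCount_eq_two (by omega)]
      · norm_num
      all_goals
        rw [mem_reducedExponents_iff_of_pos (by omega)]
        push_cast
        omega
    · refine letterCount_eq_zero fun x hx => ?_
      rw [mem_reducedExponents_iff_of_pos (by omega)] at hx
      push_cast at hx
      omega
  · rw [evenPoly_eq (by omega)]
    refine exists_growth_of_letterCount (by omega) hm one_pos (simple_roots_one hm)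
      (fun j hj => ?_) fun j hj => ?_
    · rw [lowerCoeff]
      split_ifs with h
      -- only the exponent `m` has no opposite exponent
      · rw [letterCount_eq_one]
        · norm_num
        all_goals
          rw [mem_reducedExponents_iff_of_pos (by omega)]
          push_cast
          omega
      · rw [letterCount_eq_two (by omega)]
        · norm_num
        all_goals
          rw [mem_reducedExponents_iff_of_pos (by omega)]
          push_cast
          omega
    · refine letterCount_eq_zero fun x hx => ?_
      rw [mem_reducedExponents_iff_of_pos (by omega)] at hx
      push_cast at hx
      omega
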